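/- **Setting.** Let $T$ be a locally finite tree (finite or infinite, possibly with leaves) with a root vertex $o$ that is the endpoint of exactly one edge, the root edge $\omega$. Let $E(T)$ be its edge set. For an edge $\alpha$, let $b(\alpha)$ and $e(\alpha)$ be its endpoints, $b(\alpha)$ being the one closer to $o$. Write $\beta\ge\alpha$ if the geodesic from $o$ to $e(\beta)$ passes through $\alpha$. An edge $\alpha$ is a leaf if no $\beta\neq\alpha$ satisfies $\beta\ge\alpha$. The boundary $\partial T$ is the set of half-infinite geodesics starting at $o$ together with the leaves. For $\zeta\in\partial T$, let $P(\zeta)\subseteq E(T)$ be the set of edges of the geodesic from $o$ to $\zeta$, and let $\partial T_\alpha=\{\zeta\in\partial T:\alpha\in P(\zeta)\}$; these sets are a basis of the topology of $\partial T$. For $f:E(T)\to[0,\infty)$ put $If(\zeta)=\sum_{\alpha\in P(\zeta)}f(\alpha)\in[0,\infty]$. The capacity of an arbitrary set $E\subseteq\partial T$ is $$c_2(E)=\inf\Big\{\sum_{\alpha\in E(T)}f(\alpha)^2:\ f\ge0,\ If\ge1\text{ on }E\Big\}.$$ An equilibrium measure of $E$ is a positive Borel measure $\mu$ on $\partial T$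 whose co-potential $M(\alpha)=\mu(\partial T_\alpha)$ satisfies $IM\ge1$ on $E$ outside a set of zero capacity, and $\sum_{\alpha}M(\alpha)^2=c_2(E)=\mu(\partial T)$. Squares and rectangles in the plane are closed with sides parallel to the axes; squares of side $0$ (points) are allowed. A countable family of squares $\{Q_j\}$ is a *square tiling* of a rectangle $R$ if the interiors of the $Q_j$ are pairwise disjoint, $R=\overline{\bigcup_jQ_j}$, and $R\setminus\bigcup_jQ_j$ has area zero. The combinatorics of a family $\{Q_\alpha\}_{\alpha\in E(T)}$ is *prescribed by* $T$ if the upper side of $Q_\alpha$ is contained in the lower side of $Q_\beta$ whenever $b(\alpha)=e(\beta)$. **Theorem.** (i) Every set $E\subseteq\partial T$ has a unique equilibrium measure $\mu^E$. If $c_2(E)>0$, then there is a square tiling $\{Q_\alpha\}_{\alpha\in E(T)}$ of the rectangle $[0,c_2(E)]\times[0,1]$ whose combinatorics is prescribed by $T$ and such that $Q_\alpha$ has side length $\mu^E(\partial T_\alpha)$ for every $\alpha\in E(T)$. (ii) Conversely, let $c>0$ and let $\{Q_\alpha\}_{\alpha\in E(T)}$ be a square tiling of $[0,c]\times[0,1]$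 with combinatorics prescribed by $T$. Suppose that, for every edge $\beta$ which is not a leaf and for which $Q_\beta$ has positive side, at least one edge $\alpha$ with $b(\alpha)=e(\beta)$ has $Q_\alpha$ of positive side (this holds in particular if no $Q_\alpha$ is degenerate). Then there exist an $F_\sigma$ set $E\subseteq\partial T$ and a Borel measure $\mu$ on $\partial T$ such that $\mu(\partial T_\alpha)$ is the side length of $Q_\alpha$ for every $\alpha\in E(T)$, and $\mu$ is the equilibrium measure of $E$. -/

import Mathlib

open MeasureTheory
open scoped ENNReal

noncomputable section

/-- A locally finite tree with a distinguished root vertex `o = root` which is the endpoint of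
exactly one edge, the root edge `ω`. Finite trees and trees with leaves are allowed. -/
structure PlantedTree (V : Type*) where
  graph : SimpleGraph V
  isTree : graph.IsTree
  locallyFinite : ∀ v, (graph.neighborSet v).Finite
  root : V
  existsUnique_adj_root : ∃! v, graph.Adj root v

namespace PlantedTree

variable {V : Type*}

/-- An edge `α` of the tree, written with its beginning vertex `b(α)` and its ending vertex `e(α)`:
`b(α)` is the endpoint closer to the root. Every edge of the graph has exactly one such
orientation, so this type is in bijection with the set of edges of the graph. -/
structure Edge (T : PlantedTree V) where
  b : V
  e : V
  adj : T.graph.Adj b e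
  dist_lt : T.graph.dist T.root b < T.graph.dist T.root e

variable (T : PlantedTree V)

/-- The predecessor set `P(x)` of a vertex `x`: the edges of the geodesic from the root to `x`. -/
def vertexPred (x : V) : Set T.Edge :=
  {α | ∃ p : T.graph.Walk T.root x, p.IsPath ∧ s(α.b, α.e) ∈ p.edges}

variable {T} in
/-- `α ≤ β`: the geodesic which departs from the root and ends with `β` passes through `α`. -/
def Edge.Precedes (α β : T.Edge) : Prop :=
  α ∈ T.vertexPred β.e

variable {T} in
/-- An edge is a leaf if no other edge lies beyond it. -/
def Edge.IsLeaf (α : T.Edge) : Prop :=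
  ∀ β : T.Edge, α.Precedes β → β = α

/-- The boundary `∂T`: the half-infinite geodesics starting from the root, together with
the leaves. -/
inductive Boundary : Type _
  | ray (r : ℕ → V) (zero : r 0 = T.root) (adj : ∀ n, T.graph.Adj (r n) (r (n + 1)))
      (inj : Function.Injective r) : Boundary
  | leaf (α : T.Edge) (isLeaf : α.IsLeaf) : Boundary

/-- The predecessor set `P(ζ)` of a boundary point `ζ`: the edges of the geodesic from the root
to `ζ`. -/
def pred : T.Boundary → Set T.Edge
  | .ray r _ _ _ => {α | ∃ n, α.b = r n ∧ α.e = r (n + 1)}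
  | .leaf α _ => {β | β.Precedes α}

/-- The boundary `∂T_α` of the tent rooted in `α`, as a subset of `∂T`. -/
def tentBoundary (α : T.Edge) : Set T.Boundary :=
  {ζ | α ∈ T.pred ζ}

/-- The topology on `∂T` generated by the sets `∂T_α`. -/
instance : TopologicalSpace T.Boundary :=
  TopologicalSpace.generateFrom (Set.range T.tentBoundary)

instance : MeasurableSpace T.Boundary := borel T.Boundary

instance : BorelSpace T.Boundary := ⟨rfl⟩

/-- The potential `I f (ζ)`, the sum of `f` over the edges of the geodesic from the root to `ζ`,
with values in `[0, ∞]`. -/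
def potential (f : T.Edge → ℝ≥0∞) (ζ : T.Boundary) : ℝ≥0∞ :=
  ∑' α : T.pred ζ, f α

/-- The co-potential `I^* μ (α) = μ(∂T_α)` of a measure on the boundary. -/
def copotential (μ : Measure T.Boundary) (α : T.Edge) : ℝ≥0∞ :=
  μ (T.tentBoundary α)

/-- The capacity `c_2(E)`, the infimum of `‖f‖_2^2` over the nonnegative edge functions `f` such
that `I f ≥ 1` on `E`. Functions of infinite norm do not affect the infimum, because the
indicator function of the root edge is admissible for every `E`. -/
def capacity (E : Set T.Boundary) : ℝ≥0∞ :=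
  ⨅ (f : T.Edge → ℝ≥0∞) (_ : ∀ ζ ∈ E, 1 ≤ T.potential f ζ), ∑' α, f α ^ 2

/-- `μ` is the (`2`-)equilibrium measure of `E`: its co-potential `M = I^* μ` satisfies `I M ≥ 1`
on `E` outside a set of zero capacity, and `‖M‖_2^2 = c_2(E) = μ(∂T)`. -/
structure IsEquilibriumMeasure (E : Set T.Boundary) (μ : Measure T.Boundary) : Prop where
  capacity_exceptional : T.capacity {ζ ∈ E | T.potential (T.copotential μ) ζ < 1} = 0
  energy_eq : ∑' α, T.copotential μ α ^ 2 = T.capacity E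
  mass_eq : μ Set.univ = T.capacity E

end PlantedTree

/-- An axis-parallel closed square in the plane, given by its lower left corner `(x, y)` and its
side length. Side length `0` (a square degenerated to a point) is allowed. -/
structure PlaneSquare where
  x : ℝ
  y : ℝ
  side : ℝ
  side_nonneg : 0 ≤ side

namespace PlaneSquare

/-- The square as a set of points. -/
def carrier (Q : PlaneSquare) : Set (ℝ × ℝ) :=
  Set.Icc Q.x (Q.x + Q.side) ×ˢ Set.Icc Q.y (Q.y + Q.side)

/-- The upper side of the square. -/
def upperSide (Q : PlaneSquare) : Set (ℝ × ℝ) :=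
  Set.Icc Q.x (Q.x + Q.side) ×ˢ {Q.y + Q.side}

/-- The lower side of the square. -/
def lowerSide (Q : PlaneSquare) : Set (ℝ × ℝ) :=
  Set.Icc Q.x (Q.x + Q.side) ×ˢ {Q.y}

end PlaneSquare

/-- A family of squares is a square tiling of `R`: the interiors are pairwise disjoint, `R` is the
closure of the union, and the squares exhaust the area of `R`. For a finite family the last
condition follows from the second one. -/
structure IsSquareTiling {ι : Type*} (Q : ι → PlaneSquare) (R : Set (ℝ × ℝ)) : Prop where
  disjoint_interior : ∀ i j, i ≠ j → Disjoint (interior (Q i).carrier) (interior (Q j).carrier)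
  closure_eq : closure (⋃ i, (Q i).carrier) = R
  volume_diff : volume (R \ ⋃ i, (Q i).carrier) = 0

/-- The combinatorics of a family of squares indexed by the edges of `T` is prescribed by `T`:
the upper side of `Q_α` lies in the lower side of `Q_β` whenever `b(α) = e(β)`. -/
def PlantedTree.PrescribesCombinatorics {V : Type*} (T : PlantedTree V)
    (Q : T.Edge → PlaneSquare) : Prop :=
  ∀ α β : T.Edge, α.b = β.e → (Q α).upperSide ⊆ (Q β).lowerSide

/-- Whenever `β` is not a leaf and `Q_β` is not degenerate, at least one of the squares directly
below `Q_β` is not degenerate. This holds in particular if no square is degenerate. -/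
def PlantedTree.DegeneratesOnlyProperly {V : Type*} (T : PlantedTree V)
    (Q : T.Edge → PlaneSquare) : Prop :=
  ∀ β : T.Edge, ¬ β.IsLeaf → 0 < (Q β).side → ∃ α : T.Edge, α.b = β.e ∧ 0 < (Q α).side

end

/-! ### Edges ordered outwards from the root. -/

namespace PlantedTree

variable {V : Type*} {T : PlantedTree V}

/-! The capacity is a minimum-norm problem in the Hilbert space of square summable edge functions,
over the closure of a convex set. Its minimizer `f` exists and is unique (`IsMinimizer.unique`), and
first-order variations give its structure. Moving weight from an edge to its children shows that `f`
is conserved at interior vertices (`IsMinimizer.isFlow`); trading `f` against weight on the root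
edge gives `‖f‖² = f ω`; lowering one value gives path sums at most 1 where `f` is positive. A
conserved function is the co-potential of a measure (`IsFlow.exists_measure`), which is the
equilibrium measure. Conversely, the co-potential of any equilibrium measure is the minimizer, and
values on tents determine a finite measure.

For the tiling, the flow splits `[0, f ω)` into nested intervals, which give the horizontal
positions, while path sums give the heights. The squares lie in the rectangle with disjoint
interiors, and their total area `‖f‖² = f ω` is that of the rectangle.

In the other direction the side lengths form a flow: a gap below a square would leave a vertical
strip of positive area uncovered. The resulting measure has energy equal to its mass (compare areas)
and potential at most 1 (compare heights). The integral of the potential is the energy, so the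
potential is 1 almost everywhere. An `F_σ` set of full measure on which it is at least 1 then has
the given measure as equilibrium measure, by duality between functions and measures. -/

theorem length_eq_dist {x y : V} {p : T.graph.Walk x y} (hp : p.IsPath) :
    p.length = T.graph.dist x y := by
  obtain ⟨q, hq, hl⟩ := T.isTree.connected.exists_path_of_dist x y
  rw [(T.isTree.existsUnique_path x y).unique hp hq, hl]

theorem mem_vertexPred_iff {x : V} {p : T.graph.Walk T.root x} (hp : p.IsPath) (β : T.Edge) :
    β ∈ T.vertexPred x ↔ s(β.b, β.e) ∈ p.edges := by
  constructor
  · rintro ⟨q, hq, h⟩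
    rwa [(T.isTree.existsUnique_path _ _).unique hp hq]
  · exact fun h => ⟨p, hp, h⟩

namespace Edge

/-- The distance of an edge from the root. -/
noncomputable def depth (α : T.Edge) : ℕ := T.graph.dist T.root α.b

theorem dist_e (α : T.Edge) : T.graph.dist T.root α.e = α.depth + 1 := by
  have h1 := T.isTree.dist_eq_dist_add_one_of_adj T.root α.adj
  have h2 := α.dist_lt
  unfold depth
  omega

theorem depth_of_child {α β : T.Edge} (h : β.b = α.e) : β.depth = α.depth + 1 := by
  rw [depth, h, dist_e]

theorem depth_eq_zero {α : T.Edge} : α.depth = 0 ↔ α.b = T.root := by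
  rw [depth, T.isTree.connected.dist_eq_zero_iff, eq_comm]

theorem e_ne_root (α : T.Edge) : α.e ≠ T.root := by
  intro h
  have := α.dist_e
  rw [h, SimpleGraph.dist_self] at this
  omega

theorem isPath_concat (α : T.Edge) {q : T.graph.Walk T.root α.b} (hq : q.IsPath) :
    (q.concat α.adj).IsPath := by
  classical
  refine hq.concat (fun h => ?_) α.adj
  have h1 := SimpleGraph.dist_le (q.takeUntil _ h)
  have h2 := q.length_takeUntil_le_length h
  have h3 := T.length_eq_dist hq
  have h4 := α.dist_lt
  omega

/-- The geodesic to the common end is unique, so its penultimate vertex is the beginning of both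
edges. -/
theorem eq_of_e_eq {α β : T.Edge} (h : α.e = β.e) : α = β := by
  obtain ⟨p, hp⟩ := T.isTree.connected.preconnected.exists_isPath T.root α.b
  obtain ⟨q, hq⟩ := T.isTree.connected.preconnected.exists_isPath T.root β.b
  have hp' := α.isPath_concat hp
  have hq' := β.isPath_concat hq
  cases α
  cases β
  simp only at h hp' hq' p q
  subst h
  have := (T.isTree.existsUnique_path _ _).unique hp' hq'
  have h2 := congrArg SimpleGraph.Walk.penultimate this
  simp only [SimpleGraph.Walk.penultimate_concat] at h2
  subst h2
  rfl

theorem exists_e_eq {v : V} (hv : v ≠ T.root) : ∃ α : T.Edge, α.e = v := by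
  obtain ⟨p, hp, hl⟩ := T.isTree.connected.exists_path_of_dist T.root v
  have hn : ¬ p.Nil := SimpleGraph.Walk.not_nil_of_ne hv.symm
  refine ⟨⟨p.penultimate, v, SimpleGraph.Walk.adj_penultimate hn, ?_⟩, rfl⟩
  have h1 := SimpleGraph.dist_le p.dropLast
  have h2 := SimpleGraph.Walk.length_dropLast_add_one hn
  omega

theorem exists_parent {α : T.Edge} (h : α.b ≠ T.root) : ∃ β : T.Edge, α.b = β.e :=
  (exists_e_eq h).imp fun _ h => h.symm

theorem eq_of_b_eq_root {α β : T.Edge} (hα : α.b = T.root) (hβ : β.b = T.root) : α = β :=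
  eq_of_e_eq (T.existsUnique_adj_root.unique (hα ▸ α.adj) (hβ ▸ β.adj))

theorem exists_b_eq_root (T : PlantedTree V) : ∃ α : T.Edge, α.b = T.root := by
  obtain ⟨v, hv, -⟩ := T.existsUnique_adj_root
  exact ⟨⟨T.root, v, hv, by
    rw [SimpleGraph.dist_self]; exact T.isTree.connected.pos_dist_of_ne hv.ne⟩, rfl⟩

/-- Induction on edges, from the root edge outwards. -/
theorem induction_children {P : T.Edge → Prop} (h0 : ∀ α : T.Edge, α.b = T.root → P α)
    (h1 : ∀ α β : T.Edge, β.b = α.e → P α → P β) (α : T.Edge) : P α := by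
  induction hn : α.depth generalizing α with
  | zero => exact h0 α (depth_eq_zero.1 hn)
  | succ n ih =>
    have hb : α.b ≠ T.root := fun h => by rw [depth_eq_zero.2 h] at hn; omega
    obtain ⟨β, hβ⟩ := exists_parent hb
    refine h1 β α hβ (ih β ?_)
    have := depth_of_child hβ
    omega

theorem precedes_iff {α β : T.Edge} : β.Precedes α ↔ β = α ∨ β ∈ T.vertexPred α.b := by
  obtain ⟨p, hp⟩ := T.isTree.connected.preconnected.exists_isPath T.root α.b
  rw [Precedes, mem_vertexPred_iff (α.isPath_concat hp), mem_vertexPred_iff hp,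
    SimpleGraph.Walk.edges_concat, List.concat_eq_append, List.mem_append, List.mem_singleton,
    or_comm]
  refine or_congr_left ⟨fun h => ?_, fun h => by rw [h]⟩
  rw [Sym2.eq_iff] at h
  rcases h with h | h
  · exact eq_of_e_eq h.2
  · have h1 := α.dist_lt
    have h2 := β.dist_lt
    rw [h.1, h.2] at h2
    omega

theorem precedes_root_iff {α β : T.Edge} (h : α.b = T.root) : β.Precedes α ↔ β = α := by
  rw [precedes_iff, or_iff_left]
  rw [h, mem_vertexPred_iff (SimpleGraph.Walk.IsPath.nil (u := T.root))]
  simp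

theorem precedes_child_iff {α β γ : T.Edge} (h : β.b = α.e) :
    γ.Precedes β ↔ γ = β ∨ γ.Precedes α := by
  rw [precedes_iff, h]; rfl

@[refl] theorem Precedes.refl (α : T.Edge) : α.Precedes α := precedes_iff.2 (.inl rfl)

theorem precedes_of_child {α β : T.Edge} (h : β.b = α.e) : α.Precedes β :=
  (precedes_child_iff h).2 (.inr (.refl α))

theorem Precedes.trans {α β γ : T.Edge} (h : α.Precedes β) (h' : β.Precedes γ) :
    α.Precedes γ := by
  induction γ using induction_children with
  | h0 γ hγ => rw [precedes_root_iff hγ] at h'; rwa [← h']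
  | h1 δ γ hγ ih =>
    rcases (precedes_child_iff hγ).1 h' with rfl | h'
    · exact h
    · exact (precedes_child_iff hγ).2 (.inr (ih h'))

theorem root_precedes {ω : T.Edge} (h : ω.b = T.root) (α : T.Edge) : ω.Precedes α := by
  induction α using induction_children with
  | h0 α hα => rw [eq_of_b_eq_root h hα]
  | h1 α β hβ ih => exact (precedes_child_iff hβ).2 (.inr ih)

theorem Precedes.eq_or_depth_lt {α β : T.Edge} (h : α.Precedes β) :
    α = β ∨ α.depth < β.depth := by
  induction β using induction_children with
  | h0 β hβ => exact .inl ((precedes_root_iff hβ).1 h)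
  | h1 γ β hβ ih =>
    rcases (precedes_child_iff hβ).1 h with h | h
    · exact .inl h
    · have := depth_of_child hβ
      rcases ih h with rfl | h <;> exact .inr (by omega)

theorem Precedes.depth_le {α β : T.Edge} (h : α.Precedes β) : α.depth ≤ β.depth := by
  rcases h.eq_or_depth_lt with rfl | h
  exacts [le_rfl, h.le]

theorem Precedes.eq_of_depth_eq {α β : T.Edge} (h : α.Precedes β) (hd : α.depth = β.depth) :
    α = β := h.eq_or_depth_lt.resolve_right hd.not_lt

theorem Precedes.eq_or_exists_child {α β : T.Edge} (h : α.Precedes β) :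
    α = β ∨ ∃ γ : T.Edge, γ.b = α.e ∧ γ.Precedes β := by
  induction β using induction_children with
  | h0 β hβ => exact .inl ((precedes_root_iff hβ).1 h)
  | h1 γ β hβ ih =>
    rcases (precedes_child_iff hβ).1 h with h | h
    · exact .inl h
    · right
      rcases ih h with rfl | ⟨δ, hδ, h⟩
      · exact ⟨β, hβ, .refl β⟩
      · exact ⟨δ, hδ, h.trans (precedes_of_child hβ)⟩

theorem isLeaf_iff {α : T.Edge} : α.IsLeaf ↔ ∀ β : T.Edge, β.b ≠ α.e := by
  constructor
  · intro h β hβ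
    have h1 := h β (precedes_of_child hβ)
    have h2 := depth_of_child hβ
    rw [h1] at h2
    omega
  · intro h β hβ
    rcases hβ.eq_or_exists_child with h' | ⟨γ, hγ, -⟩
    · exact h'.symm
    · exact absurd hγ (h γ)

/-- Two edges are comparable, or they lie beyond distinct edges with the same beginning. -/
theorem trichotomy (α β : T.Edge) : α.Precedes β ∨ β.Precedes α ∨
    ∃ α' β' : T.Edge, α'.b = β'.b ∧ α' ≠ β' ∧ α'.Precedes α ∧ β'.Precedes β := by
  induction α using induction_children with
  | h0 α hα => exact .inl (root_precedes hα β)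
  | h1 γ α hα ih =>
    rcases ih with h | h | ⟨γ', β', h1, h2, h3, h4⟩
    · rcases h.eq_or_exists_child with rfl | ⟨β', hβ', h⟩
      · exact .inr (.inl (precedes_of_child hα))
      · by_cases he : β' = α
        · exact .inl (he ▸ h)
        · exact .inr (.inr ⟨α, β', hα.trans hβ'.symm, Ne.symm he, .refl α, h⟩)
    · exact .inr (.inl (h.trans (precedes_of_child hα)))
    · exact .inr (.inr ⟨γ', β', h1, h2, h3.trans (precedes_of_child hα), h4⟩)

theorem Precedes.total {α β γ : T.Edge} (hα : α.Precedes γ) (hβ : β.Precedes γ) :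
    α.Precedes β ∨ β.Precedes α := by
  induction γ using induction_children with
  | h0 γ hγ =>
    rw [precedes_root_iff hγ] at hα hβ
    rw [hα, hβ]; exact .inl (.refl γ)
  | h1 δ γ hγ ih =>
    rcases (precedes_child_iff hγ).1 hα with rfl | hα'
    · exact .inr hβ
    · rcases (precedes_child_iff hγ).1 hβ with rfl | hβ'
      · exact .inl hα
      · exact ih hα' hβ'

theorem finite_setOf_b_eq (v : V) : {β : T.Edge | β.b = v}.Finite := by
  refine Set.Finite.of_finite_image (f := Edge.e) ((T.locallyFinite v).subset ?_)
    (fun α _ β _ h => eq_of_e_eq h)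
  rintro _ ⟨β, rfl, rfl⟩
  exact β.adj

theorem finite_setOf_depth_eq (n : ℕ) : {β : T.Edge | β.depth = n}.Finite := by
  induction n with
  | zero => simpa only [depth_eq_zero] using finite_setOf_b_eq T.root
  | succ n ih =>
    refine (ih.biUnion fun γ _ => finite_setOf_b_eq γ.e).subset fun β (hβ : β.depth = n + 1) => ?_
    have hb : β.b ≠ T.root := fun h => by rw [depth_eq_zero.2 h] at hβ; omega
    obtain ⟨γ, hγ⟩ := exists_parent hb
    have := depth_of_child hγ
    exact Set.mem_biUnion (show γ.depth = n by omega) hγ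

instance : Countable T.Edge := by
  rw [← Set.countable_univ_iff]
  refine (Set.countable_iUnion fun n => (finite_setOf_depth_eq (T := T) n).countable).mono ?_
  intro α _
  exact Set.mem_iUnion.2 ⟨_, rfl⟩

/-- The edges directly beyond `α`. -/
noncomputable def children (α : T.Edge) : Finset T.Edge := (finite_setOf_b_eq α.e).toFinset

@[simp] theorem mem_children {α β : T.Edge} : β ∈ α.children ↔ β.b = α.e := by
  simp [children]

theorem finite_setOf_precedes (α : T.Edge) : {β : T.Edge | β.Precedes α}.Finite := by
  induction α using induction_children with
  | h0 α hα => simp [precedes_root_iff hα]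
  | h1 γ α hα ih =>
    simp only [precedes_child_iff hα]
    exact (Set.finite_singleton α).union ih

/-- The edges of the geodesic from the root which ends with `α`. -/
noncomputable def ancestors (α : T.Edge) : Finset T.Edge := (finite_setOf_precedes α).toFinset

@[simp] theorem mem_ancestors {α β : T.Edge} : β ∈ α.ancestors ↔ β.Precedes α := by
  simp [ancestors]

/-- The sum of `f` over the geodesic from the root which ends with `α`. -/
noncomputable def pathSum {M : Type*} [AddCommMonoid M] (f : T.Edge → M) (α : T.Edge) : M :=
  ∑ β ∈ α.ancestors, f β

theorem pathSum_root {M : Type*} [AddCommMonoid M] (f : T.Edge → M) {α : T.Edge}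
    (h : α.b = T.root) : pathSum f α = f α := by
  have : α.ancestors = {α} := by ext β; simp [precedes_root_iff h]
  simp [pathSum, this]

theorem pathSum_child {M : Type*} [AddCommMonoid M] (f : T.Edge → M) {α β : T.Edge}
    (h : β.b = α.e) : pathSum f β = f β + pathSum f α := by
  classical
  have : β.ancestors = insert β α.ancestors := by ext γ; simp [precedes_child_iff h]
  rw [pathSum, this, Finset.sum_insert, pathSum]
  intro hm
  have := (mem_ancestors.1 hm).depth_le
  rw [depth_of_child h] at this
  omega

end Edge

/-! ### Boundary points as branches. -/

/-- The sets of edges which are traversed by the maximal geodesics starting at the root. -/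
structure IsBranch (S : Set T.Edge) : Prop where
  root_mem : ∀ α : T.Edge, α.b = T.root → α ∈ S
  parent_mem : ∀ α β : T.Edge, β.b = α.e → β ∈ S → α ∈ S
  exists_child : ∀ α ∈ S, ¬ α.IsLeaf → ∃ β ∈ S, β.b = α.e
  eq_of_b_eq : ∀ α ∈ S, ∀ β ∈ S, α.b = β.b → α = β

namespace IsBranch

variable {S : Set T.Edge}

theorem mem_of_precedes (hS : IsBranch S) {α β : T.Edge} (h : α.Precedes β) (hβ : β ∈ S) :
    α ∈ S := by
  induction β using Edge.induction_children with
  | h0 β hb => rwa [(Edge.precedes_root_iff hb).1 h]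
  | h1 γ β hb ih =>
    rcases (Edge.precedes_child_iff hb).1 h with rfl | h
    · exact hβ
    · exact ih h (hS.parent_mem γ β hb hβ)

theorem total (hS : IsBranch S) {α β : T.Edge} (hα : α ∈ S) (hβ : β ∈ S) :
    α.Precedes β ∨ β.Precedes α := by
  rcases Edge.trichotomy α β with h | h | ⟨α', β', h1, h2, h3, h4⟩
  · exact .inl h
  · exact .inr h
  · exact absurd (hS.eq_of_b_eq α' (hS.mem_of_precedes h3 hα) β' (hS.mem_of_precedes h4 hβ) h1) h2

/-- A branch with a leaf consists of the edges preceding that leaf. Otherwise, iterating a choice of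
child from the root edge yields a ray, injective because depth increases by one at each step. -/
theorem exists_pred_eq (hS : IsBranch S) : ∃ ζ : T.Boundary, T.pred ζ = S := by
  by_cases hl : ∃ α ∈ S, α.IsLeaf
  · obtain ⟨α, hα, hl⟩ := hl
    refine ⟨.leaf α hl, Set.ext fun β => ⟨fun h => hS.mem_of_precedes h hα, fun h => ?_⟩⟩
    rcases hS.total hα h with h | h
    · exact hl β h ▸ .refl _
    · exact h
  · push Not at hl
    choose! g hgS hg using fun α hα => hS.exists_child α hα (hl α hα)
    obtain ⟨ω, hω⟩ := Edge.exists_b_eq_root T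
    let a : ℕ → T.Edge := fun n => g^[n] ω
    have ha1 : ∀ n, a (n + 1) = g (a n) := fun n => Function.iterate_succ_apply' g n ω
    have haS : ∀ n, a n ∈ S := by
      intro n
      induction n with
      | zero => exact hS.root_mem ω hω
      | succ n ih => rw [ha1]; exact hgS _ ih
    have hab : ∀ n, (a (n + 1)).b = (a n).e := fun n => by rw [ha1]; exact hg _ (haS n)
    have had : ∀ n, (a n).depth = n := by
      intro n
      induction n with
      | zero => exact Edge.depth_eq_zero.2 hω
      | succ n ih => rw [Edge.depth_of_child (hab n), ih]
    refine ⟨.ray (fun n => (a n).b) hω (fun n => by rw [hab]; exact (a n).adj) ?_, ?_⟩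
    · intro m n h
      rw [← had m, ← had n, Edge.depth, Edge.depth]
      exact congrArg _ h
    · ext β
      constructor
      · rintro ⟨n, -, h⟩
        rw [Edge.eq_of_e_eq (h.trans (hab n))]
        exact haS n
      · intro hβ
        suffices h : a β.depth = β from
          ⟨β.depth, congrArg Edge.b h.symm, ((hab _).trans (congrArg Edge.e h)).symm⟩
        induction β using Edge.induction_children with
        | h0 β hb => rw [Edge.depth_eq_zero.2 hb]; exact Edge.eq_of_b_eq_root hω hb
        | h1 γ β hb ih =>
          refine hS.eq_of_b_eq _ (haS _) _ hβ ?_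
          rw [Edge.depth_of_child hb, hab, ih (hS.parent_mem γ β hb hβ), hb]

end IsBranch

/-- An injective walk in a tree is a geodesic. Hence every step of a ray is an edge oriented away
from the root. -/
theorem dist_ray {r : ℕ → V} (zero : r 0 = T.root) (adj : ∀ n, T.graph.Adj (r n) (r (n + 1)))
    (inj : Function.Injective r) (n : ℕ) : T.graph.dist T.root (r n) = n := by
  suffices h : ∃ p : T.graph.Walk T.root (r n), p.IsPath ∧ p.length = n ∧
      ∀ v ∈ p.support, ∃ i ≤ n, v = r i by
    obtain ⟨p, hp, hl, -⟩ := h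
    rw [← T.length_eq_dist hp, hl]
  induction n with
  | zero =>
    rw [zero]
    exact ⟨.nil, .nil, rfl, fun v hv => ⟨0, le_rfl, by simpa [zero] using hv⟩⟩
  | succ n ih =>
    obtain ⟨p, hp, hl, hs⟩ := ih
    refine ⟨p.concat (adj n), hp.concat (fun h => ?_) _, by simp [hl], fun v hv => ?_⟩
    · obtain ⟨i, hi, h⟩ := hs _ h
      have := inj h
      omega
    · rw [SimpleGraph.Walk.support_concat, List.mem_append] at hv
      rcases hv with hv | hv
      · obtain ⟨i, hi, h⟩ := hs v hv
        exact ⟨i, by omega, h⟩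
      · exact ⟨n + 1, le_rfl, by simpa using hv⟩

theorem isBranch_pred (ζ : T.Boundary) : IsBranch (T.pred ζ) := by
  cases ζ with
  | leaf l hl =>
    refine ⟨fun α hα => Edge.root_precedes hα l, fun α β h hβ => (Edge.precedes_of_child h).trans hβ,
      fun α hα h => ?_, fun α hα β hβ h => ?_⟩
    · rcases Edge.Precedes.eq_or_exists_child hα with rfl | ⟨γ, h1, h2⟩
      · exact absurd hl h
      · exact ⟨γ, h2, h1⟩
    · have hd : α.depth = β.depth := by rw [Edge.depth, h, Edge.depth]
      rcases Edge.Precedes.total hα hβ with h | h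
      · exact h.eq_of_depth_eq hd
      · exact (h.eq_of_depth_eq hd.symm).symm
  | ray r zero adj inj =>
    have hd := dist_ray zero adj inj
    refine ⟨fun α hα => ⟨0, hα.trans zero.symm, ?_⟩, ?_, ?_, ?_⟩
    · refine T.existsUnique_adj_root.unique (hα ▸ α.adj) ?_
      rw [← zero]; exact adj 0
    · rintro α β h ⟨n, h1, -⟩
      rcases n with _ | n
      · exact absurd (h.symm.trans (h1.trans zero)) α.e_ne_root
      · let γ : T.Edge := ⟨r n, r (n + 1), adj n, by rw [hd, hd]; omega⟩
        have : α = γ := Edge.eq_of_e_eq (h.symm.trans h1)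
        exact ⟨n, by rw [this], by rw [this]⟩
    · rintro α ⟨n, -, h2⟩ -
      exact ⟨⟨r (n + 1), r (n + 2), adj _, by rw [hd, hd]; omega⟩, ⟨n + 1, rfl, rfl⟩, h2.symm⟩
    · rintro α ⟨n, h1, h2⟩ β ⟨m, h3, h4⟩ h
      have : n = m := inj (h1.symm.trans (h.trans h3))
      subst this
      exact Edge.eq_of_e_eq (h2.trans h4.symm)

/-- The potential is the supremum of the partial sums along the geodesic. -/
theorem potential_eq_iSup (f : T.Edge → ℝ≥0∞) (ζ : T.Boundary) :
    T.potential f ζ = ⨆ α ∈ T.pred ζ, Edge.pathSum f α := by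
  classical
  have hS := isBranch_pred ζ
  rw [potential, tsum_subtype]
  apply le_antisymm
  · rw [ENNReal.tsum_eq_iSup_sum]
    refine iSup_le fun s => ?_
    -- A branch is totally ordered, so the edges of a finite set that lie on it all precede one of
    -- its edges.
    have h : ∃ α ∈ T.pred ζ, ∀ β ∈ s, β ∈ T.pred ζ → β.Precedes α := by
      induction s using Finset.induction_on with
      | empty =>
        obtain ⟨ω, hω⟩ := Edge.exists_b_eq_root T
        exact ⟨ω, hS.root_mem ω hω, by simp⟩
      | insert γ s _ ih =>
        obtain ⟨α, hα, h⟩ := ih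
        by_cases hγ : γ ∈ T.pred ζ
        · rcases hS.total hα hγ with h' | h'
          · refine ⟨γ, hγ, fun β hβ hβ' => ?_⟩
            rcases Finset.mem_insert.1 hβ with rfl | hβ
            · exact .refl _
            · exact (h β hβ hβ').trans h'
          · refine ⟨α, hα, fun β hβ hβ' => ?_⟩
            rcases Finset.mem_insert.1 hβ with rfl | hβ
            · exact h'
            · exact h β hβ hβ'
        · refine ⟨α, hα, fun β hβ hβ' => ?_⟩
          rcases Finset.mem_insert.1 hβ with rfl | hβ
          · exact absurd hβ' hγ
          · exact h β hβ hβ'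
    obtain ⟨α, hα, h⟩ := h
    refine le_trans ?_ (le_iSup₂ (f := fun α (_ : α ∈ T.pred ζ) => Edge.pathSum f α) α hα)
    rw [Edge.pathSum, Finset.sum_indicator_eq_sum_filter]
    refine Finset.sum_le_sum_of_subset fun β hβ => ?_
    rw [Finset.mem_filter] at hβ
    exact Edge.mem_ancestors.2 (h β hβ.1 hβ.2)
  · refine iSup₂_le fun α hα => ?_
    refine le_trans (Finset.sum_le_sum fun β hβ => ?_) (ENNReal.sum_le_tsum α.ancestors)
    rw [Set.indicator_of_mem (hS.mem_of_precedes (Edge.mem_ancestors.1 hβ) hα)]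

end PlantedTree

/-! ### Topology and Borel structure of the boundary. -/

namespace PlantedTree

variable {V : Type*} {T : PlantedTree V}

@[simp] theorem mem_tentBoundary {α : T.Edge} {ζ : T.Boundary} :
    ζ ∈ T.tentBoundary α ↔ α ∈ T.pred ζ := Iff.rfl

theorem tentBoundary_root {ω : T.Edge} (h : ω.b = T.root) : T.tentBoundary ω = Set.univ :=
  Set.eq_univ_of_forall fun ζ => (isBranch_pred ζ).root_mem ω h

theorem tentBoundary_subset {α β : T.Edge} (h : α.Precedes β) :
    T.tentBoundary β ⊆ T.tentBoundary α :=
  fun ζ hζ => (isBranch_pred ζ).mem_of_precedes h hζ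

theorem isOpen_tentBoundary (α : T.Edge) : IsOpen (T.tentBoundary α) :=
  TopologicalSpace.isOpen_generateFrom_of_mem ⟨α, rfl⟩

/-- Where `S` leaves the geodesic to `α` it takes another edge `γ`, and no branch through `γ` can
return to `α`. This makes tents closed. -/
theorem exists_mem_pred_disjoint {S : Set T.Edge} (hS : IsBranch S) {α : T.Edge} (hα : α ∉ S) :
    ∃ γ ∈ S, ∀ S', IsBranch S' → γ ∈ S' → α ∉ S' := by
  induction α using Edge.induction_children with
  | h0 α h => exact absurd (hS.root_mem α h) hα
  | h1 β α h ih =>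
    by_cases hβ : β ∈ S
    · obtain ⟨γ, hγ, hb⟩ := hS.exists_child β hβ fun hl => Edge.isLeaf_iff.1 hl α h
      refine ⟨γ, hγ, fun S' hS' hγ' hα' => hα ?_⟩
      rwa [hS'.eq_of_b_eq α hα' γ hγ' (h.trans hb.symm)]
    · obtain ⟨γ, hγ, h'⟩ := ih hβ
      exact ⟨γ, hγ, fun S' hS' hγ' hα' => h' S' hS' hγ' (hS'.parent_mem β α h hα')⟩

theorem isClosed_tentBoundary (α : T.Edge) : IsClosed (T.tentBoundary α) := by
  rw [← isOpen_compl_iff, isOpen_iff_mem_nhds]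
  intro ζ hζ
  obtain ⟨γ, hγ, h⟩ := exists_mem_pred_disjoint (isBranch_pred ζ) hζ
  filter_upwards [(isOpen_tentBoundary γ).mem_nhds hγ] with ξ hξ
  exact h _ (isBranch_pred ξ) hξ

instance : SecondCountableTopology T.Boundary :=
  ⟨⟨_, Set.countable_range T.tentBoundary, rfl⟩⟩

/-- Tents are clopen. With second countability this gives pseudometrizability, hence the inner
regularity by closed sets that later produces an `F_σ` set. -/
instance : RegularSpace T.Boundary := by
  rw [regularSpace_generateFrom (s := Set.range T.tentBoundary) rfl]
  rintro _ ⟨α, rfl⟩ ζ hζ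
  rw [(isClosed_tentBoundary α).isOpen_compl.nhdsSet_eq, Filter.disjoint_principal_left,
    compl_compl]
  exact (isOpen_tentBoundary α).mem_nhds hζ

theorem measurableSet_tentBoundary (α : T.Edge) : MeasurableSet (T.tentBoundary α) :=
  (isOpen_tentBoundary α).measurableSet

theorem measurableSpace_boundary_eq : borel T.Boundary =
    MeasurableSpace.generateFrom (Set.range T.tentBoundary) :=
  borel_eq_generateFrom_of_subbasis rfl

/-- Two tents that meet are nested, because edges on a common branch are comparable. -/
theorem isPiSystem_range_tentBoundary : IsPiSystem (Set.range T.tentBoundary) := by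
  rintro _ ⟨α, rfl⟩ _ ⟨β, rfl⟩ ⟨ζ, h1, h2⟩
  rcases (isBranch_pred ζ).total h1 h2 with h | h
  · exact ⟨β, (Set.inter_eq_right.2 (tentBoundary_subset h)).symm⟩
  · exact ⟨α, (Set.inter_eq_left.2 (tentBoundary_subset h)).symm⟩

theorem measure_ext {μ ν : Measure T.Boundary} [IsFiniteMeasure μ]
    (h : ∀ α, μ (T.tentBoundary α) = ν (T.tentBoundary α)) : μ = ν := by
  refine ext_of_generate_finite _ measurableSpace_boundary_eq isPiSystem_range_tentBoundary ?_ ?_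
  · rintro _ ⟨α, rfl⟩
    exact h α
  · obtain ⟨ω, hω⟩ := Edge.exists_b_eq_root T
    rw [← tentBoundary_root hω, h]

theorem potential_eq_tsum_indicator (f : T.Edge → ℝ≥0∞) (ζ : T.Boundary) :
    T.potential f ζ = ∑' α, (T.tentBoundary α).indicator (fun _ => f α) ζ := by
  rw [potential, tsum_subtype]
  rfl

theorem measurable_potential (f : T.Edge → ℝ≥0∞) : Measurable (T.potential f) := by
  rw [funext (potential_eq_tsum_indicator f)]
  exact Measurable.tsum fun α => measurable_const.indicator (measurableSet_tentBoundary α)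

theorem lintegral_potential (f : T.Edge → ℝ≥0∞) (μ : Measure T.Boundary) :
    ∫⁻ ζ, T.potential f ζ ∂μ = ∑' α, f α * T.copotential μ α := by
  simp_rw [potential_eq_tsum_indicator]
  rw [lintegral_tsum fun α =>
    (measurable_const.indicator (measurableSet_tentBoundary α)).aemeasurable]
  congr 1 with α
  rw [lintegral_indicator_const (measurableSet_tentBoundary α), copotential]

/-! ### Flows, nested intervals and measures on the boundary. -/

/-- The partial sums of a nonnegative function along an enumeration of a finite set partition an
interval. -/
theorem _root_.Finset.exists_mem_Ico_sum_filter_lt {ι : Type*} {r : ι → ℕ}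
    (hr : Function.Injective r) {m : ι → ℝ} (s : Finset ι) {t : ℝ} (h0 : 0 ≤ t)
    (ht : t < ∑ i ∈ s, m i) :
    ∃ i ∈ s, t ∈ Set.Ico (∑ j ∈ s with r j < r i, m j) (∑ j ∈ s with r j < r i, m j + m i) := by
  classical
  induction s using Finset.induction_on_max_value r with
  | empty => simp at ht; linarith
  | insert a s ha hmax ih =>
    have hlt : ∀ x ∈ s, r x < r a := fun x hx =>
      lt_of_le_of_ne (hmax x hx) fun h => ha (hr h ▸ hx)
    by_cases hs : t < ∑ i ∈ s, m i
    · obtain ⟨i, hi, h⟩ := ih hs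
      refine ⟨i, Finset.mem_insert_of_mem hi, ?_⟩
      rwa [Finset.filter_insert, if_neg (hlt i hi).not_gt]
    · refine ⟨a, Finset.mem_insert_self _ _, ?_⟩
      rw [Finset.filter_insert, if_neg (lt_irrefl _), Finset.filter_true_of_mem hlt]
      rw [Finset.sum_insert ha] at ht
      exact ⟨not_lt.1 hs, by linarith⟩

theorem _root_.Finset.sum_filter_lt_add_le {ι : Type*} {r : ι → ℕ} {m : ι → ℝ}
    (hm : ∀ i, 0 ≤ m i) {s : Finset ι} {i : ι} (hi : i ∈ s) :
    ∑ j ∈ s with r j < r i, m j + m i ≤ ∑ j ∈ s, m j := by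
  classical
  rw [add_comm, ← Finset.sum_insert (by simp)]
  refine Finset.sum_le_sum_of_subset_of_nonneg ?_ fun j _ _ => hm j
  exact Finset.insert_subset hi (Finset.filter_subset _ _)

theorem _root_.Finset.sum_filter_lt_add_le_sum_filter_lt {ι : Type*} {r : ι → ℕ} {m : ι → ℝ}
    (hm : ∀ i, 0 ≤ m i) {s : Finset ι} {i k : ι} (hi : i ∈ s) (hik : r i < r k) :
    ∑ j ∈ s with r j < r i, m j + m i ≤ ∑ j ∈ s with r j < r k, m j := by
  classical
  rw [add_comm, ← Finset.sum_insert (by simp)]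
  refine Finset.sum_le_sum_of_subset_of_nonneg ?_ fun j _ _ => hm j
  intro j hj
  rw [Finset.mem_insert, Finset.mem_filter] at hj
  rw [Finset.mem_filter]
  rcases hj with rfl | ⟨h1, h2⟩
  · exact ⟨hi, hik⟩
  · exact ⟨h1, h2.trans hik⟩

/-- A nonnegative function which is conserved at every interior vertex. -/
structure IsFlow (m : T.Edge → ℝ) : Prop where
  nonneg : ∀ α, 0 ≤ m α
  sum_children : ∀ α : T.Edge, ¬ α.IsLeaf → ∑ β ∈ α.children, m β = m α

namespace Edge

/-- An enumeration of the edges, used to order the edges with a common beginning. -/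
noncomputable def rank : T.Edge → ℕ := (exists_injective_nat T.Edge).choose

theorem rank_injective : Function.Injective (rank : T.Edge → ℕ) :=
  (exists_injective_nat T.Edge).choose_spec

/-- The edges with the same beginning. -/
noncomputable def siblings (α : T.Edge) : Finset T.Edge := (finite_setOf_b_eq α.b).toFinset

@[simp] theorem mem_siblings {α β : T.Edge} : β ∈ α.siblings ↔ β.b = α.b := by
  simp [siblings]

theorem siblings_congr {α β : T.Edge} (h : α.b = β.b) : α.siblings = β.siblings := by
  ext γ; simp [h]

theorem siblings_eq_children {α β : T.Edge} (h : β.b = α.e) : β.siblings = α.children := by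
  ext γ; simp [h]

/-- The flow through the siblings which precede `α` in the enumeration. -/
noncomputable def offset (m : T.Edge → ℝ) (α : T.Edge) : ℝ :=
  ∑ β ∈ α.siblings with β.rank < α.rank, m β

/-- The left end of the interval which the flow `m` assigns to `α`. -/
noncomputable def left (m : T.Edge → ℝ) (α : T.Edge) : ℝ := pathSum (offset m) α

theorem left_root (m : T.Edge → ℝ) {α : T.Edge} (h : α.b = T.root) : left m α = 0 := by
  rw [left, pathSum_root _ h, offset, Finset.sum_eq_zero]
  intro β hβ
  rw [Finset.mem_filter, mem_siblings] at hβ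
  have := eq_of_b_eq_root (hβ.1.trans h) h
  rw [this] at hβ
  exact absurd hβ.2 (lt_irrefl _)

theorem left_child (m : T.Edge → ℝ) {α β : T.Edge} (h : β.b = α.e) :
    left m β = left m α + offset m β := by
  rw [left, pathSum_child _ h, left, add_comm]

theorem left_siblings (m : T.Edge → ℝ) {α β : T.Edge} (h : α.b = β.b) :
    left m β - left m α = offset m β - offset m α := by
  by_cases hr : α.b = T.root
  · rw [eq_of_b_eq_root hr (h ▸ hr)]; ring
  · obtain ⟨γ, hγ⟩ := exists_parent hr
    rw [left_child m hγ, left_child m (h.symm.trans hγ)]; ring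

end Edge

namespace IsFlow

open Edge

variable {m : T.Edge → ℝ}

theorem left_le_left (hm : IsFlow m) {α β : T.Edge} (h : β.b = α.e) : left m α ≤ left m β := by
  rw [left_child m h, offset]
  linarith [Finset.sum_nonneg fun γ (_ : γ ∈ β.siblings.filter (·.rank < β.rank)) => hm.nonneg γ]

theorem right_le_right (hm : IsFlow m) {α β : T.Edge} (h : β.b = α.e) :
    left m β + m β ≤ left m α + m α := by
  have := Finset.sum_filter_lt_add_le (r := rank) hm.nonneg (mem_siblings.2 (Eq.refl β.b))
  rw [left_child m h, offset, ← hm.sum_children α fun hl => isLeaf_iff.1 hl β h,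
    ← siblings_eq_children h]
  linarith

theorem bounds_of_precedes (hm : IsFlow m) {α β : T.Edge} (h : α.Precedes β) :
    left m α ≤ left m β ∧ left m β + m β ≤ left m α + m α := by
  induction β using induction_children with
  | h0 β hβ => rw [(precedes_root_iff hβ).1 h]; simp
  | h1 γ β hβ ih =>
    rcases (precedes_child_iff hβ).1 h with rfl | h
    · simp
    · exact ⟨(ih h).1.trans (hm.left_le_left hβ), (hm.right_le_right hβ).trans (ih h).2⟩

theorem separated (hm : IsFlow m) {α β : T.Edge} (h : α.b = β.b) (hne : α ≠ β) :
    left m α + m α ≤ left m β ∨ left m β + m β ≤ left m α := by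
  have h1 := left_siblings m h
  rcases (rank_injective.ne hne).lt_or_gt with hr | hr
  · left
    have := Finset.sum_filter_lt_add_le_sum_filter_lt (r := rank) hm.nonneg
      (mem_siblings.2 (Eq.refl α.b)) hr
    rw [offset, offset, siblings_congr h.symm] at h1
    linarith
  · right
    have := Finset.sum_filter_lt_add_le_sum_filter_lt (r := rank) hm.nonneg
      (mem_siblings.2 (Eq.refl β.b)) hr
    rw [offset, offset, siblings_congr h] at h1
    linarith

/-- By conservation, the intervals of the children partition that of their parent. Half-open
intervals ensure that `t` selects exactly one child. -/
theorem isBranch (hm : IsFlow m) {ω : T.Edge} (hω : ω.b = T.root) {t : ℝ}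
    (ht : t ∈ Set.Ico 0 (m ω)) :
    IsBranch {α : T.Edge | t ∈ Set.Ico (left m α) (left m α + m α)} where
  root_mem α h := by
    rw [eq_of_b_eq_root h hω, Set.mem_ofPred_eq, left_root m hω, zero_add]
    exact ht
  parent_mem α β h hβ := ⟨(hm.left_le_left h).trans hβ.1, hβ.2.trans_le (hm.right_le_right h)⟩
  exists_child α hα hl := by
    obtain ⟨β, hβ, h⟩ := Finset.exists_mem_Ico_sum_filter_lt (r := rank) rank_injective (m := m)
      α.children (sub_nonneg.2 hα.1) (by rw [hm.sum_children α hl]; linarith [hα.2])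
    rw [mem_children] at hβ
    refine ⟨β, ?_, hβ⟩
    rw [← siblings_eq_children hβ] at h
    have h1 := h.1
    have h2 := h.2
    constructor
    · rw [left_child m hβ, offset]; linarith
    · rw [left_child m hβ, offset]; linarith
  eq_of_b_eq α hα β hβ h := by
    by_contra hne
    rcases hm.separated h hne with h | h
    · linarith [hα.2, hβ.1]
    · linarith [hα.1, hβ.2]

/-- Every flow is the co-potential of a measure on the boundary. -/
theorem exists_measure (hm : IsFlow m) :
    ∃ μ : Measure T.Boundary, ∀ α, μ (T.tentBoundary α) = ENNReal.ofReal (m α) := by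
  obtain ⟨ω, hω⟩ := exists_b_eq_root T
  -- The measure is the image of Lebesgue measure under `Φ`, which sends `t` to the end of the
  -- branch of edges whose intervals contain `t`.
  choose Φ hΦ using fun t : Set.Ico 0 (m ω) => (hm.isBranch hω t.2).exists_pred_eq
  have hpre : ∀ α, Subtype.val '' (Φ ⁻¹' T.tentBoundary α) =
      Set.Ico (left m α) (left m α + m α) := by
    intro α
    ext t
    simp only [Set.mem_image, Set.mem_preimage, mem_tentBoundary, hΦ, Set.mem_ofPred_eq]
    constructor
    · rintro ⟨s, hs, rfl⟩
      exact hs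
    · intro ht
      have h := hm.bounds_of_precedes (root_precedes hω α)
      rw [left_root m hω, zero_add] at h
      exact ⟨⟨t, h.1.trans ht.1, ht.2.trans_le h.2⟩, ht, rfl⟩
  have hmeas : ∀ α, MeasurableSet (Φ ⁻¹' T.tentBoundary α) := fun α => by
    rw [← Set.preimage_image_eq (Φ ⁻¹' T.tentBoundary α) Subtype.val_injective, hpre]
    exact measurable_subtype_coe measurableSet_Ico
  have hΦm : Measurable Φ := by
    refine (measurable_generateFrom ?_).mono le_rfl measurableSpace_boundary_eq.le
    rintro _ ⟨α, rfl⟩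
    exact hmeas α
  refine ⟨((volume : Measure ℝ).comap Subtype.val).map Φ, fun α => ?_⟩
  rw [Measure.map_apply hΦm (measurableSet_tentBoundary α),
    Measure.comap_apply _ Subtype.val_injective
      (fun _ => measurableSet_Ico.subtype_image) _ (hmeas α), hpre, Real.volume_Ico]
  congr 1; ring

end IsFlow

end PlantedTree

/-! ### Capacity and the Hilbert space of edge functions. -/

namespace PlantedTree

variable {V : Type*} {T : PlantedTree V}

open Edge Filter Topology

section Capacity

theorem capacity_le_of_potential {E : Set T.Boundary} {f : T.Edge → ℝ≥0∞}
    (h : ∀ ζ ∈ E, 1 ≤ T.potential f ζ) : T.capacity E ≤ ∑' α, f α ^ 2 :=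
  iInf₂_le f h

theorem potential_mono {f g : T.Edge → ℝ≥0∞} (h : ∀ α, f α ≤ g α) (ζ : T.Boundary) :
    T.potential f ζ ≤ T.potential g ζ :=
  ENNReal.tsum_le_tsum fun _ => h _

theorem potential_add (f g : T.Edge → ℝ≥0∞) (ζ : T.Boundary) :
    T.potential (fun α => f α + g α) ζ = T.potential f ζ + T.potential g ζ :=
  ENNReal.tsum_add

theorem potential_const_mul (c : ℝ≥0∞) (f : T.Edge → ℝ≥0∞) (ζ : T.Boundary) :
    T.potential (fun α => c * f α) ζ = c * T.potential f ζ :=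
  ENNReal.tsum_mul_left

theorem capacity_mono {E F : Set T.Boundary} (h : E ⊆ F) : T.capacity E ≤ T.capacity F :=
  le_iInf₂ fun _ hf => capacity_le_of_potential fun ζ hζ => hf ζ (h hζ)

open Classical in
theorem capacity_le_one (E : Set T.Boundary) : T.capacity E ≤ 1 := by
  obtain ⟨ω, hω⟩ := Edge.exists_b_eq_root T
  refine (capacity_le_of_potential (f := Pi.single ω 1) fun ζ _ => ?_).trans_eq ?_
  · rw [potential_eq_iSup]
    refine le_trans ?_ (le_iSup₂ (f := fun α (_ : α ∈ T.pred ζ) => pathSum (Pi.single ω 1) α) ω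
      ((isBranch_pred ζ).root_mem ω hω))
    rw [pathSum_root _ hω, Pi.single_eq_same]
  · rw [tsum_eq_single ω fun α hα => by rw [Pi.single_eq_of_ne hα]; simp]
    simp

theorem capacity_ne_top (E : Set T.Boundary) : T.capacity E ≠ ∞ :=
  ((capacity_le_one E).trans_lt ENNReal.one_lt_top).ne

@[simp] theorem capacity_empty : T.capacity (∅ : Set T.Boundary) = 0 :=
  le_antisymm ((capacity_le_of_potential (f := fun _ => 0) (by simp)).trans_eq (by simp)) zero_le

theorem exists_potential_of_capacity_lt {E : Set T.Boundary} {c : ℝ≥0∞} (h : T.capacity E < c) :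
    ∃ f : T.Edge → ℝ≥0∞, (∀ ζ ∈ E, 1 ≤ T.potential f ζ) ∧ ∑' α, f α ^ 2 < c := by
  simpa only [capacity, iInf_lt_iff, exists_prop] using h

/-- The pointwise supremum of nearly optimal functions is admissible for the union, and the square
of a supremum is at most the sum of the squares. -/
theorem capacity_iUnion_eq_zero {E : ℕ → Set T.Boundary} (h : ∀ n, T.capacity (E n) = 0) :
    T.capacity (⋃ n, E n) = 0 := by
  refine le_antisymm (le_of_forall_gt fun ε hε => ?_) zero_le
  obtain ⟨δ, hδ, hs⟩ := ENNReal.exists_pos_sum_of_countable' hε.ne' ℕ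
  choose f hf hfδ using fun n => exists_potential_of_capacity_lt ((h n).trans_lt (hδ n))
  have hle : ∀ n α, f n α ≤ ⨆ n, f n α := fun n α => le_iSup (fun n => f n α) n
  refine (capacity_le_of_potential (f := fun α => ⨆ n, f n α) fun ζ hζ => ?_).trans_lt
    (lt_of_le_of_lt ?_ hs)
  · obtain ⟨n, hn⟩ := Set.mem_iUnion.1 hζ
    exact (hf n ζ hn).trans (potential_mono (hle n) ζ)
  · calc ∑' α, (⨆ n, f n α) ^ 2 ≤ ∑' α, ∑' n, f n α ^ 2 := by
          refine ENNReal.tsum_le_tsum fun α => ?_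
          rw [ENNReal.iSup_pow]
          exact iSup_le fun n => ENNReal.le_tsum n
      _ = ∑' n, ∑' α, f n α ^ 2 := ENNReal.tsum_comm
      _ ≤ ∑' n, δ n := ENNReal.tsum_le_tsum fun n => (hfδ n).le

end Capacity

variable (T) in
/-- The Hilbert space of square summable functions on the edges. -/
abbrev EdgeL2 : Type _ := lp (fun _ : T.Edge => ℝ) 2

namespace EdgeL2

theorem add_apply (f g : T.EdgeL2) (α : T.Edge) : (f + g) α = f α + g α := rfl

theorem sub_apply (f g : T.EdgeL2) (α : T.Edge) : (f - g) α = f α - g α := rfl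

theorem smul_apply (c : ℝ) (f : T.EdgeL2) (α : T.Edge) : (c • f) α = c * f α := rfl

theorem tsum_ofReal_abs_sq (g : T.EdgeL2) :
    ∑' α, ENNReal.ofReal |g α| ^ 2 = ENNReal.ofReal (‖g‖ ^ 2) := by
  have h := lp.hasSum_norm (p := 2) (by norm_num) g
  simp only [ENNReal.toReal_ofNat, Real.rpow_ofNat, Real.norm_eq_abs] at h
  rw [← h.tsum_eq, ENNReal.ofReal_tsum_of_nonneg (fun α => by positivity) h.summable]
  simp_rw [ENNReal.ofReal_pow (abs_nonneg _)]

theorem tsum_ofReal_sq_le (g : T.EdgeL2) :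
    ∑' α, ENNReal.ofReal (g α) ^ 2 ≤ ENNReal.ofReal (‖g‖ ^ 2) := by
  rw [← tsum_ofReal_abs_sq]
  gcongr
  exact le_abs_self _

theorem tsum_ofReal_sq {g : T.EdgeL2} (hg : ∀ α, 0 ≤ g α) :
    ∑' α, ENNReal.ofReal (g α) ^ 2 = ENNReal.ofReal (‖g‖ ^ 2) := by
  rw [← tsum_ofReal_abs_sq]
  simp_rw [abs_of_nonneg (hg _)]

theorem exists_ofReal_eq {f : T.Edge → ℝ≥0∞} (hf : ∑' α, f α ^ 2 ≠ ∞) :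
    ∃ g : T.EdgeL2, (∀ α, 0 ≤ g α) ∧ (fun α => ENNReal.ofReal (g α)) = f := by
  have hfin : ∀ α, f α ≠ ∞ := fun α h => by
    have := ENNReal.ne_top_of_tsum_ne_top hf α
    simp [h] at this
  have hs : Memℓp (E := fun _ : T.Edge => ℝ) (fun α => (f α).toReal) 2 := by
    refine memℓp_gen ?_
    simp only [ENNReal.toReal_ofNat, Real.rpow_ofNat, Real.norm_eq_abs, sq_abs]
    simpa only [ENNReal.toReal_pow] using ENNReal.summable_toReal hf
  exact ⟨⟨_, hs⟩, fun α => ENNReal.toReal_nonneg, funext fun α => ENNReal.ofReal_toReal (hfin α)⟩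

open Classical in
/-- The indicator function of an edge. -/
noncomputable def unit (α : T.Edge) : T.EdgeL2 := lp.single 2 α 1

@[simp] theorem unit_self (α : T.Edge) : unit α α = 1 := by
  classical exact lp.single_apply_self ..

theorem unit_ne {α β : T.Edge} (h : β ≠ α) : unit α β = 0 := by
  classical exact lp.single_apply_ne _ _ _ h

theorem inner_unit (f : T.EdgeL2) (α : T.Edge) : inner ℝ f (unit α) = f α := by
  classical
  rw [unit, lp.inner_single_right]
  simp

theorem continuous_eval (α : T.Edge) : Continuous fun f : T.EdgeL2 => f α := by
  simp_rw [← inner_unit]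
  fun_prop

theorem continuous_pathSum (α : T.Edge) : Continuous fun f : T.EdgeL2 => pathSum f α :=
  continuous_finsetSum _ fun β _ => continuous_eval β

theorem pathSum_add (f g : T.EdgeL2) (α : T.Edge) :
    pathSum (f + g : T.EdgeL2) α = pathSum f α + pathSum g α :=
  Finset.sum_add_distrib

theorem pathSum_sub (f g : T.EdgeL2) (α : T.Edge) :
    pathSum (f - g : T.EdgeL2) α = pathSum f α - pathSum g α :=
  Finset.sum_sub_distrib _ _

theorem pathSum_smul (c : ℝ) (f : T.EdgeL2) (α : T.Edge) :
    pathSum (c • f : T.EdgeL2) α = c * pathSum f α :=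
  (Finset.mul_sum ..).symm

theorem pathSum_sum {ι : Type*} (s : Finset ι) (f : ι → T.EdgeL2) (α : T.Edge) :
    pathSum (∑ i ∈ s, f i : T.EdgeL2) α = ∑ i ∈ s, pathSum (f i) α := by
  classical
  induction s using Finset.induction_on with
  | empty => exact Finset.sum_const_zero
  | insert i s hi ih => rw [Finset.sum_insert hi, Finset.sum_insert hi, pathSum_add, ih]

theorem pathSum_unit_of_precedes {α β : T.Edge} (h : α.Precedes β) : pathSum (unit α) β = 1 :=
  (Finset.sum_eq_single (f := fun γ => unit α γ) α (fun _ _ h => unit_ne h)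
    fun h' => absurd (mem_ancestors.2 h) h').trans (unit_self α)

theorem pathSum_unit_of_not_precedes {α β : T.Edge} (h : ¬ α.Precedes β) :
    pathSum (unit α) β = 0 :=
  Finset.sum_eq_zero fun _ hγ => unit_ne fun h' => h (h' ▸ mem_ancestors.1 hγ)

end EdgeL2

open EdgeL2

theorem ofReal_pathSum_le (f : T.Edge → ℝ) (α : T.Edge) :
    ENNReal.ofReal (pathSum f α) ≤ pathSum (fun β => ENNReal.ofReal (f β)) α := by
  unfold pathSum
  exact Finset.le_sum_of_subadditive ENNReal.ofReal ENNReal.ofReal_zero.le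
    (fun _ _ => ENNReal.ofReal_add_le) _ _

theorem pathSum_ofReal {f : T.Edge → ℝ} (hf : ∀ α, 0 ≤ f α) (α : T.Edge) :
    pathSum (fun β => ENNReal.ofReal (f β)) α = ENNReal.ofReal (pathSum f α) :=
  (ENNReal.ofReal_sum_of_nonneg fun β _ => hf β).symm

/-- Here `f` may be negative: passing to the positive part only raises path sums and lowers the
norm. Variations may therefore leave the cone of nonnegative functions. -/
theorem one_le_potential {f : T.Edge → ℝ} {ζ : T.Boundary}
    (h : ∀ ε > 0, ∃ α ∈ T.pred ζ, 1 - ε < pathSum f α) :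
    1 ≤ T.potential (fun α => ENNReal.ofReal (f α)) ζ := by
  refine le_of_forall_lt fun c hc => ?_
  lift c to NNReal using hc.ne_top
  obtain ⟨α, hα, h⟩ := h (1 - c) (sub_pos.2 (by exact_mod_cast hc))
  rw [potential_eq_iSup]
  refine lt_of_lt_of_le ?_ (le_iSup₂ (f := fun α (_ : α ∈ T.pred ζ) => pathSum _ α) α hα)
  refine lt_of_lt_of_le ?_ (ofReal_pathSum_le f α)
  rw [← ENNReal.ofReal_coe_nnreal, ENNReal.ofReal_lt_ofReal_iff_of_nonneg c.coe_nonneg]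
  linarith

theorem exists_lt_pathSum {f : T.Edge → ℝ} (hf : ∀ α, 0 ≤ f α) {ζ : T.Boundary}
    (h : 1 ≤ T.potential (fun α => ENNReal.ofReal (f α)) ζ) {ε : ℝ} (hε : 0 < ε) :
    ∃ α ∈ T.pred ζ, 1 - ε < pathSum f α := by
  have h1 : ENNReal.ofReal (1 - ε) < T.potential (fun α => ENNReal.ofReal (f α)) ζ :=
    lt_of_lt_of_le (by rw [ENNReal.ofReal_lt_one]; linarith) h
  rw [potential_eq_iSup] at h1
  simp only [lt_iSup_iff] at h1
  obtain ⟨α, hα, h⟩ := h1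
  rw [pathSum_ofReal hf] at h
  exact ⟨α, hα, (ENNReal.ofReal_lt_ofReal_iff').1 h |>.1⟩

theorem pathSum_mono {f : T.Edge → ℝ} (hf : ∀ α, 0 ≤ f α) {α β : T.Edge} (h : α.Precedes β) :
    pathSum f α ≤ pathSum f β :=
  Finset.sum_le_sum_of_subset_of_nonneg
    (fun _ hγ => mem_ancestors.2 ((mem_ancestors.1 hγ).trans h)) fun γ _ _ => hf γ

/-- The square summable functions which are admissible for the capacity of `E`. -/
def admissible (E : Set T.Boundary) : Set T.EdgeL2 :=
  {f | (∀ α, 0 ≤ f α) ∧ ∀ ζ ∈ E, 1 ≤ T.potential (fun α => ENNReal.ofReal (f α)) ζ}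

theorem convex_admissible (E : Set T.Boundary) : Convex ℝ (admissible E) := by
  intro f hf g hg a b ha hb hab
  refine ⟨fun α => ?_, fun ζ hζ => ?_⟩
  · have h1 := mul_nonneg ha (hf.1 α)
    have h2 := mul_nonneg hb (hg.1 α)
    exact add_nonneg h1 h2
  · have : (fun α => ENNReal.ofReal ((a • f + b • g : T.EdgeL2) α)) = fun α =>
        ENNReal.ofReal a * ENNReal.ofReal (f α) + ENNReal.ofReal b * ENNReal.ofReal (g α) := by
      ext α
      rw [add_apply, smul_apply, smul_apply, ENNReal.ofReal_add (mul_nonneg ha (hf.1 α)) (mul_nonneg hb (hg.1 α)),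
        ENNReal.ofReal_mul ha, ENNReal.ofReal_mul hb]
    rw [this, potential_add, potential_const_mul, potential_const_mul]
    calc (1 : ℝ≥0∞) = ENNReal.ofReal a * 1 + ENNReal.ofReal b * 1 := by
          rw [mul_one, mul_one, ← ENNReal.ofReal_add ha hb, hab, ENNReal.ofReal_one]
      _ ≤ _ := add_le_add (mul_le_mul_right (hf.2 ζ hζ) _) (mul_le_mul_right (hg.2 ζ hζ) _)

theorem capacity_le_norm_sq {E : Set T.Boundary} {f : T.EdgeL2}
    (h : ∀ ζ ∈ E, 1 ≤ T.potential (fun α => ENNReal.ofReal (f α)) ζ) :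
    T.capacity E ≤ ENNReal.ofReal (‖f‖ ^ 2) :=
  (capacity_le_of_potential h).trans (tsum_ofReal_sq_le f)

theorem exists_admissible_of_capacity_lt {E : Set T.Boundary} {c : ℝ} (hc : 0 ≤ c)
    (h : T.capacity E < ENNReal.ofReal (c ^ 2)) : ∃ f ∈ admissible E, ‖f‖ < c := by
  obtain ⟨f, hf, hfc⟩ := exists_potential_of_capacity_lt h
  obtain ⟨g, hg, rfl⟩ := exists_ofReal_eq (hfc.trans_le le_top).ne
  rw [tsum_ofReal_sq hg, ENNReal.ofReal_lt_ofReal_iff_of_nonneg (by positivity)] at hfc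
  exact ⟨g, ⟨hg, hf⟩, lt_of_pow_lt_pow_left₀ 2 hc hfc⟩

/-! ### The minimizer and its first-order conditions. -/

/-- `f` attains the capacity of `E` in the closure of the admissible functions. -/
structure IsMinimizer (E : Set T.Boundary) (f : T.EdgeL2) : Prop where
  mem_closure : f ∈ closure (admissible E)
  norm_sq : ENNReal.ofReal (‖f‖ ^ 2) = T.capacity E

theorem capacity_le_of_mem_closure {E : Set T.Boundary} {f : T.EdgeL2}
    (h : f ∈ closure (admissible E)) : T.capacity E ≤ ENNReal.ofReal (‖f‖ ^ 2) := by
  have hc : IsClosed {f : T.EdgeL2 | T.capacity E ≤ ENNReal.ofReal (‖f‖ ^ 2)} :=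
    isClosed_le continuous_const (ENNReal.continuous_ofReal.comp (by fun_prop))
  exact closure_minimal (fun f hf => capacity_le_norm_sq hf.2) hc h

/-- Project the origin onto the closed convex hull of competitors, which is the closure of the
already convex admissible set. -/
theorem exists_isMinimizer (E : Set T.Boundary) : ∃ f, IsMinimizer E f := by
  have hlt : ∀ c > 0, T.capacity E < ENNReal.ofReal ((√(T.capacity E).toReal + c) ^ 2) := by
    intro c hc
    rw [ENNReal.lt_ofReal_iff_toReal_lt (capacity_ne_top E)]
    nth_rewrite 1 [← Real.sq_sqrt (ENNReal.toReal_nonneg (a := T.capacity E))]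
    have := Real.sqrt_nonneg (T.capacity E).toReal
    gcongr
    linarith
  have hne : (closure (admissible E)).Nonempty := by
    obtain ⟨f, hf, -⟩ := exists_admissible_of_capacity_lt (by positivity) (hlt 1 one_pos)
    exact ⟨f, subset_closure hf⟩
  obtain ⟨f, hf, hmin⟩ := exists_norm_eq_iInf_of_complete_convex hne isClosed_closure.isComplete
    (convex_admissible E).closure 0
  refine ⟨f, hf, le_antisymm ?_ (capacity_le_of_mem_closure hf)⟩
  rw [← ENNReal.ofReal_toReal (capacity_ne_top E)]
  refine ENNReal.ofReal_le_ofReal ?_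
  rw [← Real.sq_sqrt (ENNReal.toReal_nonneg (a := T.capacity E))]
  refine pow_le_pow_left₀ (norm_nonneg _) (le_of_forall_pos_le_add fun c hc => ?_) 2
  obtain ⟨g, hg, hgc⟩ := exists_admissible_of_capacity_lt (by positivity) (hlt c hc)
  refine le_trans ?_ hgc.le
  have := ciInf_le (f := fun w : closure (admissible E) => ‖(0 : T.EdgeL2) - w‖)
    ⟨0, Set.forall_mem_range.2 fun _ => norm_nonneg _⟩ ⟨g, subset_closure hg⟩
  rw [← hmin] at this
  simpa using this

namespace IsMinimizer

variable {E : Set T.Boundary} {f : T.EdgeL2}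

theorem norm_le (hf : IsMinimizer E f) {g : T.EdgeL2}
    (hg : T.capacity E ≤ ENNReal.ofReal (‖g‖ ^ 2)) : ‖f‖ ≤ ‖g‖ := by
  rw [← hf.norm_sq, ENNReal.ofReal_le_ofReal_iff (by positivity)] at hg
  exact le_of_sq_le_sq hg (norm_nonneg _)

/-- The midpoint of two minimizers is again a competitor, so the parallelogram law forces their
difference to vanish. -/
theorem unique (hf : IsMinimizer E f) {g : T.EdgeL2} (hg : IsMinimizer E g) : f = g := by
  have h1 : ‖f‖ = ‖g‖ := le_antisymm (hf.norm_le hg.norm_sq.ge) (hg.norm_le hf.norm_sq.ge)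
  have h2 : (1 / 2 : ℝ) • f + (1 / 2 : ℝ) • g ∈ closure (admissible E) :=
    (convex_admissible E).closure hf.mem_closure hg.mem_closure (by norm_num) (by norm_num)
      (by norm_num)
  have h3 := hf.norm_le (capacity_le_of_mem_closure h2)
  rw [← smul_add, norm_smul, Real.norm_of_nonneg (by norm_num)] at h3
  have h4 := parallelogram_law_with_norm ℝ f g
  have h5 : ‖f - g‖ * ‖f - g‖ ≤ 0 := by nlinarith [norm_nonneg f, norm_nonneg (f + g)]
  rw [← sub_eq_zero, ← norm_eq_zero]
  nlinarith [norm_nonneg (f - g)]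

theorem nonneg (hf : IsMinimizer E f) (α : T.Edge) : 0 ≤ f α :=
  closure_minimal (fun _ hg => hg.1 α : admissible E ⊆ {f | 0 ≤ f α})
    (isClosed_le continuous_const (continuous_eval α)) hf.mem_closure

/-- The minimizer has the smallest norm among its admissible variations. -/
theorem norm_le_of_eventually (hf : IsMinimizer E f) {L : T.EdgeL2 → T.EdgeL2}
    (hL : Continuous L)
    (h : ∀ᶠ g in 𝓝 f, g ∈ admissible E →
      ∀ ζ ∈ E, ∀ ε > 0, ∃ α ∈ T.pred ζ, 1 - ε < pathSum (L g) α) : ‖f‖ ≤ ‖L f‖ := by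
  -- Since `f` itself need not be admissible, `L` is applied to admissible approximants and the
  -- bound passes to the limit.
  have : (𝓝[admissible E] f).NeBot := mem_closure_iff_nhdsWithin_neBot.1 hf.mem_closure
  refine ge_of_tendsto (hL.norm.continuousAt.tendsto.mono_left
    (nhdsWithin_le_nhds (s := admissible E))) ?_
  filter_upwards [nhdsWithin_le_nhds h, self_mem_nhdsWithin] with g hg hgE
  exact hf.norm_le (capacity_le_norm_sq fun ζ hζ => one_le_potential (hg hgE ζ hζ))

theorem inner_nonneg_of_norm_le {g : T.EdgeL2} {s : ℝ} (hs : 0 < s)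
    (h : ∀ t, 0 < t → t < s → ‖f‖ ≤ ‖f + t • g‖) : 0 ≤ inner ℝ f g := by
  by_contra! hlt
  set a := inner ℝ f g with ha
  have hb : 0 ≤ ‖g‖ ^ 2 := by positivity
  -- This `t` makes `2 * a + t * ‖g‖ ^ 2` negative; the `+ 1` avoids division by zero.
  set t := min (s / 2) (-a / (‖g‖ ^ 2 + 1)) with ht
  have ht0 : 0 < t := lt_min (by linarith) (div_pos (by linarith) (by linarith))
  have h1 := h t ht0 ((min_le_left _ _).trans_lt (by linarith))
  have h2 : t * (‖g‖ ^ 2 + 1) ≤ -a := by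
    rw [← le_div_iff₀ (by linarith)]; exact min_le_right _ _
  have h3 := norm_add_sq_real f (t • g)
  rw [inner_smul_right, norm_smul, ← ha, Real.norm_of_nonneg ht0.le] at h3
  have h4 := pow_le_pow_left₀ (norm_nonneg _) h1 2
  have h5 : 0 ≤ t * (2 * a + t * ‖g‖ ^ 2) := by nlinarith
  have h6 := nonneg_of_mul_nonneg_right h5 ht0
  nlinarith

/-- Every geodesic contains `ω`, so scaling by `1 - t` and adding `t` at `ω` keeps potentials at
least 1. As `t` may have either sign, `f` is orthogonal to `unit ω - f`. -/
theorem norm_sq_eq_apply_root (hf : IsMinimizer E f) {ω : T.Edge} (hω : ω.b = T.root) :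
    ‖f‖ ^ 2 = f ω := by
  have key : ∀ t : ℝ, t < 1 → ‖f‖ ≤ ‖f + t • (unit ω - f)‖ := by
    intro t ht
    refine hf.norm_le_of_eventually (L := fun g => g + t • (unit ω - g)) (by fun_prop)
      (Eventually.of_forall fun g hg ζ hζ ε hε => ?_)
    have ht' : 0 < 1 - t := by linarith
    obtain ⟨α, hα, h⟩ := exists_lt_pathSum hg.1 (hg.2 ζ hζ) (div_pos hε ht')
    refine ⟨α, hα, ?_⟩
    have : g + t • (unit ω - g) = (1 - t) • g + t • unit ω := by module
    rw [this, pathSum_add, pathSum_smul, pathSum_smul,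
      pathSum_unit_of_precedes (root_precedes hω α)]
    have h1 : (1 - ε / (1 - t)) * (1 - t) = 1 - t - ε := by field_simp
    nlinarith
  have h1 := inner_nonneg_of_norm_le (f := f) one_pos fun t _ ht => key t ht
  have h2 := inner_nonneg_of_norm_le (f := f) (g := -(unit ω - f)) one_pos fun t h0 _ => by
    have := key (-t) (by linarith)
    rwa [neg_smul, ← smul_neg] at this
  rw [inner_neg_right] at h2
  rw [inner_sub_right, inner_unit, real_inner_self_eq_norm_sq] at h1 h2
  linarith

/-- Moving weight from `α` to all its children leaves unchanged the sum along any geodesic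
continuing beyond `α`. Both signs are allowed, so `f` is orthogonal to this variation. -/
theorem isFlow (hf : IsMinimizer E f) : IsFlow f := by
  refine ⟨hf.nonneg, fun α hα => ?_⟩
  set g : T.EdgeL2 := ∑ β ∈ α.children, unit β - unit α with hg
  have hsum : ∀ γ, pathSum g γ = ∑ β ∈ α.children, pathSum (unit β) γ - pathSum (unit α) γ := by
    intro γ
    rw [hg, pathSum_sub, pathSum_sum]
  have h0 : ∀ γ, ¬ α.Precedes γ → pathSum g γ = 0 := by
    intro γ h
    rw [hsum, pathSum_unit_of_not_precedes h, sub_zero]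
    refine Finset.sum_eq_zero fun β hβ => pathSum_unit_of_not_precedes fun h' => h ?_
    exact (precedes_of_child (mem_children.1 hβ)).trans h'
  have h1 : ∀ γ β : T.Edge, β.b = α.e → β.Precedes γ → pathSum g γ = 0 := by
    intro γ β hb h
    rw [hsum, pathSum_unit_of_precedes ((precedes_of_child hb).trans h),
      Finset.sum_eq_single β, pathSum_unit_of_precedes h, sub_self]
    · intro δ hδ hne
      refine pathSum_unit_of_not_precedes fun h' => hne ?_
      have hd : δ.depth = β.depth := by
        rw [depth_of_child hb, depth_of_child (mem_children.1 hδ)]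
      rcases h.total h' with h | h
      · exact (h.eq_of_depth_eq hd.symm).symm
      · exact h.eq_of_depth_eq hd
    · intro h'
      exact absurd (mem_children.2 hb) h'
  have key : ∀ t : ℝ, ‖f‖ ≤ ‖f + t • g‖ := by
    intro t
    refine hf.norm_le_of_eventually (L := fun h => h + t • g) (by fun_prop)
      (Eventually.of_forall fun h hh ζ hζ ε hε => ?_)
    have hS := isBranch_pred ζ
    obtain ⟨γ, hγ, hlt⟩ := exists_lt_pathSum hh.1 (hh.2 ζ hζ) hε
    -- The path sum of `g` is nonzero exactly when the path ends at `α`; then one goes on to the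
    -- next edge, which exists as `α` is not a leaf.
    obtain ⟨γ', hγ', hle, hz⟩ : ∃ γ' ∈ T.pred ζ, γ.Precedes γ' ∧ pathSum g γ' = 0 := by
      by_cases hαγ : α.Precedes γ
      · obtain ⟨β, hβ, hb⟩ := hS.exists_child α (hS.mem_of_precedes hαγ hγ) hα
        rcases hS.total hβ hγ with h' | h'
        · exact ⟨γ, hγ, .refl γ, h1 γ β hb h'⟩
        · exact ⟨β, hβ, h', h1 β β hb (.refl β)⟩
      · exact ⟨γ, hγ, .refl γ, h0 γ hαγ⟩
    refine ⟨γ', hγ', ?_⟩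
    rw [pathSum_add, pathSum_smul, hz, mul_zero, add_zero]
    exact hlt.trans_le (pathSum_mono hh.1 hle)
  have h2 := inner_nonneg_of_norm_le (f := f) one_pos fun t _ _ => key t
  have h3 := inner_nonneg_of_norm_le (f := f) (g := -g) one_pos fun t _ _ => by
    have := key (-t)
    rwa [neg_smul, ← smul_neg] at this
  rw [inner_neg_right] at h3
  have h4 : inner ℝ f g = ∑ β ∈ α.children, f β - f α := by
    rw [hg, inner_sub_right, inner_sum, inner_unit]
    simp_rw [inner_unit]
  linarith

/-- If the sum up to `α` exceeded 1, slightly lowering the value at `α` would keep all constraints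
and decrease the norm. The strict excess is an open condition, so it persists for nearby admissible
functions. -/
theorem pathSum_le_one (hf : IsMinimizer E f) {α : T.Edge} (hα : 0 < f α) : pathSum f α ≤ 1 := by
  by_contra! hlt
  have key : ∀ t, 0 < t → t < pathSum f α - 1 → ‖f‖ ≤ ‖f + t • -unit α‖ := by
    intro t ht0 ht
    refine hf.norm_le_of_eventually (L := fun g => g + t • -unit α) (by fun_prop) ?_
    filter_upwards [(continuous_pathSum α).continuousAt.eventually (lt_mem_nhds
      (show 1 + t < pathSum f α by linarith))] with g hgα hg ζ hζ ε hε
    have hsum : ∀ γ, pathSum (g + t • -unit α : T.EdgeL2) γ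
        = pathSum g γ - t * pathSum (unit α) γ := by
      intro γ
      rw [smul_neg, ← neg_smul, pathSum_add, pathSum_smul]
      ring
    by_cases hαζ : α ∈ T.pred ζ
    · refine ⟨α, hαζ, ?_⟩
      rw [hsum, pathSum_unit_of_precedes (.refl α)]
      linarith
    · obtain ⟨γ, hγ, h⟩ := exists_lt_pathSum hg.1 (hg.2 ζ hζ) hε
      refine ⟨γ, hγ, ?_⟩
      rw [hsum, pathSum_unit_of_not_precedes fun h =>
        hαζ ((isBranch_pred ζ).mem_of_precedes h hγ)]
      linarith
  have h1 := inner_nonneg_of_norm_le (f := f) (sub_pos.2 hlt) key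
  rw [inner_neg_right, inner_unit] at h1
  linarith

/-- A Chebyshev argument: where the potential of `f` is at most `1 - 1/c`, an admissible `g`
satisfies `I|g - f| ≥ 1/c`, so that set has capacity at most `c² ‖g - f‖²`. Let `g` tend to `f`,
then take a countable union over `c`. -/
theorem capacity_exceptional (hf : IsMinimizer E f) :
    T.capacity {ζ ∈ E | T.potential (fun α => ENNReal.ofReal (f α)) ζ < 1} = 0 := by
  set u := T.potential (fun α => ENNReal.ofReal (f α)) with hu
  have hsub : {ζ ∈ E | u ζ < 1} ⊆ ⋃ n : ℕ, {ζ ∈ E | u ζ + ((n : ℝ≥0∞) + 1)⁻¹ ≤ 1} := by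
    rintro ζ ⟨hζ, hlt⟩
    obtain ⟨n, hn⟩ := ENNReal.exists_inv_nat_lt (tsub_pos_iff_lt.2 hlt).ne'
    refine Set.mem_iUnion.2 ⟨n, hζ, ?_⟩
    calc u ζ + ((n : ℝ≥0∞) + 1)⁻¹ ≤ u ζ + (1 - u ζ) := by
          gcongr
          refine le_trans (ENNReal.inv_le_inv.2 ?_) hn.le
          exact le_self_add
      _ = 1 := add_tsub_cancel_of_le hlt.le
  refine le_antisymm ((capacity_mono hsub).trans_eq (capacity_iUnion_eq_zero fun n => ?_)) zero_le
  set c : ℝ≥0∞ := (n : ℝ≥0∞) + 1 with hc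
  have hc0 : c ≠ 0 := by positivity
  have hct : c ≠ ∞ := by finiteness
  have hle : ∀ g ∈ admissible E, T.capacity {ζ ∈ E | u ζ + c⁻¹ ≤ 1} ≤
      c ^ 2 * ENNReal.ofReal (‖g - f‖ ^ 2) := by
    intro g hg
    refine (capacity_le_of_potential
      (f := fun α => c * ENNReal.ofReal |(g - f : T.EdgeL2) α|) ?_).trans_eq ?_
    · rintro ζ ⟨hζ, h⟩
      rw [potential_const_mul]
      have hut : u ζ ≠ ∞ := fun h' => by simp [h'] at h
      have h1 : T.potential (fun α => ENNReal.ofReal (g α)) ζ ≤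
          u ζ + T.potential (fun α => ENNReal.ofReal |(g - f : T.EdgeL2) α|) ζ := by
        rw [hu, ← potential_add]
        refine potential_mono (fun α => ?_) ζ
        rw [← ENNReal.ofReal_add (hf.nonneg α) (abs_nonneg _)]
        refine ENNReal.ofReal_le_ofReal ?_
        have := le_abs_self ((g - f : T.EdgeL2) α)
        rw [sub_apply] at this ⊢
        linarith
      have h2 := (h.trans (hg.2 ζ hζ)).trans h1
      rw [ENNReal.add_le_add_iff_left hut] at h2
      calc (1 : ℝ≥0∞) = c * c⁻¹ := (ENNReal.mul_inv_cancel hc0 hct).symm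
        _ ≤ _ := mul_le_mul_right h2 c
    · simp_rw [mul_pow]
      rw [ENNReal.tsum_mul_left, tsum_ofReal_abs_sq]
  have : (𝓝[admissible E] f).NeBot := mem_closure_iff_nhdsWithin_neBot.1 hf.mem_closure
  refine le_antisymm ?_ zero_le
  have hcont : Continuous fun g : T.EdgeL2 => c ^ 2 * ENNReal.ofReal (‖g - f‖ ^ 2) :=
    (ENNReal.continuous_const_mul (by finiteness)).comp
      (ENNReal.continuous_ofReal.comp (by fun_prop))
  have ht := hcont.continuousAt.tendsto.mono_left (nhdsWithin_le_nhds (a := f) (s := admissible E))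
  simp only [sub_self, norm_zero, ne_eq, OfNat.ofNat_ne_zero, not_false_eq_true, zero_pow,
    ENNReal.ofReal_zero, mul_zero] at ht
  exact ge_of_tendsto ht (eventually_nhdsWithin_of_forall hle)

end IsMinimizer

/-! ### Existence and uniqueness of equilibrium measures. -/

namespace IsEquilibriumMeasure

variable {E : Set T.Boundary} {μ : Measure T.Boundary}

theorem exists_isMinimizer (hμ : T.IsEquilibriumMeasure E μ) :
    ∃ f, IsMinimizer E f ∧ ∀ α, μ (T.tentBoundary α) = ENNReal.ofReal (f α) := by
  obtain ⟨f, hf, hfM⟩ := exists_ofReal_eq (f := T.copotential μ)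
    (by rw [hμ.energy_eq]; exact capacity_ne_top E)
  refine ⟨f, ⟨?_, ?_⟩, fun α => (congrFun hfM α).symm⟩
  · refine Metric.mem_closure_iff.2 fun ε hε => ?_
    -- Adding a function of norm below `ε` that is admissible for the exceptional null set makes the
    -- co-potential admissible for all of `E`.
    obtain ⟨g, hg, hlt⟩ := exists_admissible_of_capacity_lt
      (E := {ζ ∈ E | T.potential (T.copotential μ) ζ < 1}) hε.le
      (by rw [hμ.capacity_exceptional]; simpa using pow_pos hε 2)
    refine ⟨f + g, ⟨fun α => ?_, fun ζ hζ => ?_⟩, by simpa [dist_eq_norm] using hlt⟩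
    · exact add_nonneg (hf α) (hg.1 α)
    · by_cases h : T.potential (T.copotential μ) ζ < 1
      · refine (hg.2 ζ ⟨hζ, h⟩).trans (potential_mono (fun α => ENNReal.ofReal_le_ofReal ?_) ζ)
        exact le_add_of_nonneg_left (hf α)
      · refine (not_lt.1 h).trans ?_
        rw [← hfM]
        refine potential_mono (fun α => ENNReal.ofReal_le_ofReal ?_) ζ
        exact le_add_of_nonneg_right (hg.1 α)
  · rw [← tsum_ofReal_sq hf, ← hμ.energy_eq, ← hfM]

end IsEquilibriumMeasure

theorem exists_isEquilibriumMeasure (E : Set T.Boundary) : ∃ μ, T.IsEquilibriumMeasure E μ := by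
  obtain ⟨f, hf⟩ := exists_isMinimizer E
  obtain ⟨μ, hμ⟩ := hf.isFlow.exists_measure
  have hM : T.copotential μ = fun α => ENNReal.ofReal (f α) := funext hμ
  obtain ⟨ω, hω⟩ := exists_b_eq_root T
  refine ⟨μ, ?_, ?_, ?_⟩
  · rw [hM]; exact hf.capacity_exceptional
  · rw [hM, tsum_ofReal_sq hf.nonneg, hf.norm_sq]
  · rw [← tentBoundary_root hω, hμ, ← hf.norm_sq_eq_apply_root hω, hf.norm_sq]

theorem existsUnique_isEquilibriumMeasure (E : Set T.Boundary) :
    ∃! μ, T.IsEquilibriumMeasure E μ := by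
  obtain ⟨μ, hμ⟩ := exists_isEquilibriumMeasure E
  refine ⟨μ, hμ, fun ν hν => ?_⟩
  obtain ⟨f, hf, hfμ⟩ := hμ.exists_isMinimizer
  obtain ⟨g, hg, hgν⟩ := hν.exists_isMinimizer
  have : IsFiniteMeasure ν :=
    ⟨by rw [hν.mass_eq]; exact (capacity_le_one E).trans_lt ENNReal.one_lt_top⟩
  exact measure_ext fun α => by rw [hfμ, hgν, hf.unique hg]

end PlantedTree

/-! ### Areas of squares and tilings. -/

namespace PlaneSquare

theorem interior_carrier (Q : PlaneSquare) :
    interior Q.carrier = Set.Ioo Q.x (Q.x + Q.side) ×ˢ Set.Ioo Q.y (Q.y + Q.side) := by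
  rw [carrier, interior_prod_eq, interior_Icc, interior_Icc]

theorem isClosed_carrier (Q : PlaneSquare) : IsClosed Q.carrier := isClosed_Icc.prod isClosed_Icc

theorem volume_carrier (Q : PlaneSquare) : volume Q.carrier = ENNReal.ofReal Q.side ^ 2 := by
  rw [carrier, Measure.volume_eq_prod, Measure.prod_prod, Real.volume_Icc, Real.volume_Icc,
    add_sub_cancel_left, add_sub_cancel_left, sq]

theorem interior_ae_eq_carrier (Q : PlaneSquare) :
    (interior Q.carrier : Set (ℝ × ℝ)) =ᵐ[volume] Q.carrier := by
  refine ae_eq_of_subset_of_measure_ge interior_subset ?_ measurableSet_interior.nullMeasurableSet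
    (by rw [volume_carrier]; finiteness)
  rw [volume_carrier, interior_carrier, Measure.volume_eq_prod, Measure.prod_prod,
    Real.volume_Ioo, Real.volume_Ioo, add_sub_cancel_left, add_sub_cancel_left, sq]

theorem volume_iUnion_carrier {ι : Type*} [Countable ι] {Q : ι → PlaneSquare}
    (h : ∀ i j, i ≠ j → Disjoint (interior (Q i).carrier) (interior (Q j).carrier)) :
    volume (⋃ i, (Q i).carrier) = ∑' i, ENNReal.ofReal (Q i).side ^ 2 := by
  rw [measure_iUnion₀ (fun i j hij => ?_)
    fun i => (Q i).isClosed_carrier.measurableSet.nullMeasurableSet]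
  · simp_rw [volume_carrier]
  · rw [Function.onFun, AEDisjoint, ← measure_congr
      ((Q i).interior_ae_eq_carrier.inter (Q j).interior_ae_eq_carrier),
      (h i j hij).inter_eq, measure_empty]

end PlaneSquare

theorem volume_rectangle (c : ℝ) :
    volume (Set.Icc 0 c ×ˢ Set.Icc 0 1 : Set (ℝ × ℝ)) = ENNReal.ofReal c := by
  rw [Measure.volume_eq_prod, Measure.prod_prod, Real.volume_Icc, Real.volume_Icc]
  simp

theorem IsSquareTiling.tsum_sq {ι : Type*} [Countable ι] {Q : ι → PlaneSquare} {c : ℝ}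
    (h : IsSquareTiling Q (Set.Icc 0 c ×ˢ Set.Icc 0 1)) :
    ∑' i, ENNReal.ofReal (Q i).side ^ 2 = ENNReal.ofReal c := by
  rw [← PlaneSquare.volume_iUnion_carrier h.disjoint_interior, ← volume_rectangle]
  refine le_antisymm (measure_mono (subset_closure.trans h.closure_eq.subset)) ?_
  refine (measure_le_inter_add_sdiff _ _ (⋃ i, (Q i).carrier)).trans ?_
  rw [h.volume_diff, add_zero]
  exact measure_mono Set.inter_subset_right

/-- Squares in a rectangle with disjoint interiors and full area tile the rectangle. -/
theorem isSquareTiling_of_tsum_sq {ι : Type*} [Countable ι] {Q : ι → PlaneSquare} {c : ℝ}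
    (hc : 0 < c) (hsub : ∀ i, (Q i).carrier ⊆ Set.Icc 0 c ×ˢ Set.Icc 0 1)
    (hdisj : ∀ i j, i ≠ j → Disjoint (interior (Q i).carrier) (interior (Q j).carrier))
    (hsum : ∑' i, ENNReal.ofReal (Q i).side ^ 2 = ENNReal.ofReal c) :
    IsSquareTiling Q (Set.Icc 0 c ×ˢ Set.Icc 0 1) := by
  have hU : ⋃ i, (Q i).carrier ⊆ Set.Icc 0 c ×ˢ Set.Icc 0 1 := Set.iUnion_subset hsub
  have hR : IsClosed (Set.Icc 0 c ×ˢ Set.Icc 0 1 : Set (ℝ × ℝ)) := isClosed_Icc.prod isClosed_Icc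
  have hdiff : volume ((Set.Icc 0 c ×ˢ Set.Icc 0 1) \ ⋃ i, (Q i).carrier) = 0 := by
    have hm : MeasurableSet (⋃ i, (Q i).carrier) :=
      MeasurableSet.iUnion fun i => (Q i).isClosed_carrier.measurableSet
    have hv := PlaneSquare.volume_iUnion_carrier hdisj
    rw [measure_sdiff hU hm.nullMeasurableSet (by rw [hv, hsum]; finiteness), hv, hsum,
      volume_rectangle, tsub_self]
  refine ⟨hdisj, Set.Subset.antisymm (closure_minimal hU hR) ?_, hdiff⟩
  have hint : closure (interior (Set.Icc 0 c ×ˢ Set.Icc 0 1 : Set (ℝ × ℝ))) =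
      Set.Icc 0 c ×ˢ Set.Icc 0 1 := by
    rw [interior_prod_eq, closure_prod_eq, interior_Icc, interior_Icc, closure_Ioo hc.ne,
      closure_Ioo one_ne_zero.symm]
  rw [← hint]
  refine closure_minimal (fun p hp => ?_) isClosed_closure
  by_contra hpc
  -- An interior point outside the closure would give a nonempty open set, hence positive area,
  -- missed by the squares.
  have hopen : IsOpen (interior (Set.Icc 0 c ×ˢ Set.Icc 0 1 : Set (ℝ × ℝ)) ∩
      (closure (⋃ i, (Q i).carrier))ᶜ) := isOpen_interior.inter isClosed_closure.isOpen_compl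
  refine (hopen.measure_pos volume ⟨p, hp, hpc⟩).ne' (measure_mono_null ?_ hdiff)
  exact fun q hq => ⟨interior_subset hq.1, fun h => hq.2 (subset_closure h)⟩

/-! ### From the minimizer to a tiling. -/

namespace PlantedTree

variable {V : Type*} {T : PlantedTree V}

open Edge

theorem IsMinimizer.exists_isSquareTiling {E : Set T.Boundary} {f : T.EdgeL2}
    (hf : IsMinimizer E f) (hE : 0 < T.capacity E) :
    ∃ Q : T.Edge → PlaneSquare,
      IsSquareTiling Q (Set.Icc 0 (T.capacity E).toReal ×ˢ Set.Icc 0 1) ∧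
      T.PrescribesCombinatorics Q ∧ ∀ α, (Q α).side = f α := by
  obtain ⟨ω, hω⟩ := exists_b_eq_root T
  have hfl := hf.isFlow
  have hroot : (T.capacity E).toReal = f ω := by
    rw [← hf.norm_sq, ENNReal.toReal_ofReal (by positivity), hf.norm_sq_eq_apply_root hω]
  have hpos : 0 < f ω := hroot ▸ ENNReal.toReal_pos hE.ne' (capacity_ne_top E)
  -- The variational bound needs `f α > 0`; an edge of value zero inherits the bound from its
  -- parent.
  have hle : ∀ α, pathSum f α ≤ 1 := by
    intro α
    induction α using induction_children with
    | h0 α hα => exact hf.pathSum_le_one (by rwa [eq_of_b_eq_root hα hω])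
    | h1 α β hβ ih =>
      rcases (hf.nonneg β).eq_or_lt with h | h
      · rw [pathSum_child _ hβ, ← h, zero_add]; exact ih
      · exact hf.pathSum_le_one h
  have hself : ∀ α β : T.Edge, α.Precedes β → α ≠ β → pathSum f α + f β ≤ pathSum f β := by
    intro α β h hne
    induction β using induction_children with
    | h0 β hβ => exact absurd ((precedes_root_iff hβ).1 h) hne
    | h1 γ β hβ _ =>
      have := pathSum_mono hf.nonneg (((precedes_child_iff hβ).1 h).resolve_left hne)
      rw [pathSum_child _ hβ]
      linarith
  have hfle : ∀ α, f α ≤ pathSum f α := fun α =>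
    Finset.single_le_sum (f := fun β => f β) (fun β _ => hf.nonneg β) (mem_ancestors.2 (.refl α))
  -- Squares hang from height 1. Comparable edges are separated vertically by path sums,
  -- incomparable ones horizontally by their intervals.
  let Q : T.Edge → PlaneSquare := fun α => ⟨left f α, 1 - pathSum f α, f α, hf.nonneg α⟩
  have hint : ∀ α, interior (Q α).carrier = Set.Ioo (left f α) (left f α + f α) ×ˢ
      Set.Ioo (1 - pathSum f α) (1 - pathSum f α + f α) := fun α => (Q α).interior_carrier
  have hcomp : ∀ α β : T.Edge, α.Precedes β → α ≠ β →
      Disjoint (interior (Q α).carrier) (interior (Q β).carrier) := by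
    intro α β h hne
    rw [hint, hint, Set.disjoint_prod]
    refine .inr (Set.disjoint_left.2 fun y h1 h2 => ?_)
    linarith [h1.1, h2.2, hself α β h hne]
  refine ⟨Q, ?_, ?_, fun α => rfl⟩
  · rw [hroot]
    refine isSquareTiling_of_tsum_sq hpos (fun α => ?_) (fun α β hne => ?_) ?_
    · have h := hfl.bounds_of_precedes (root_precedes hω α)
      rw [left_root _ hω, zero_add] at h
      exact Set.prod_mono (Set.Icc_subset_Icc h.1 h.2)
        (Set.Icc_subset_Icc (sub_nonneg.2 (hle α)) (by
          have := hfle α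
          change 1 - pathSum f α + f α ≤ 1
          linarith))
    · rcases trichotomy α β with h | h | ⟨α', β', h1, h2, h3, h4⟩
      · exact hcomp α β h hne
      · exact (hcomp β α h hne.symm).symm
      · have hα := hfl.bounds_of_precedes h3
        have hβ := hfl.bounds_of_precedes h4
        rw [hint, hint, Set.disjoint_prod]
        refine .inl (Set.disjoint_left.2 fun x hx hx' => ?_)
        rcases hfl.separated h1 h2 with h | h
        · linarith [hx.2, hx'.1]
        · linarith [hx.1, hx'.2]
    · rw [EdgeL2.tsum_ofReal_sq hf.nonneg, hf.norm_sq_eq_apply_root hω]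
  · intro α β h
    refine Set.prod_mono (Set.Icc_subset_Icc (hfl.left_le_left h) (hfl.right_le_right h)) ?_
    rw [Set.singleton_subset_singleton]
    change 1 - pathSum f α + f α = 1 - pathSum f β
    rw [pathSum_child _ h]
    ring

end PlantedTree

theorem ENNReal.two_mul_mul_le_sq_add_sq (a b : ℝ≥0∞) : 2 * (a * b) ≤ a ^ 2 + b ^ 2 := by
  wlog h : a ≤ b generalizing a b
  · rw [mul_comm a, add_comm]
    exact this b a (le_of_not_ge h)
  obtain ⟨d, rfl⟩ := exists_add_of_le h
  calc 2 * (a * (a + d)) ≤ 2 * (a * (a + d)) + d ^ 2 := le_self_add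
    _ = a ^ 2 + (a + d) ^ 2 := by ring

/-! ### From a tiling to a flow. -/

namespace PlantedTree

variable {V : Type*} {T : PlantedTree V}

open Edge

namespace PrescribesCombinatorics

variable {Q : T.Edge → PlaneSquare}

theorem bounds_of_child (hC : T.PrescribesCombinatorics Q) {α β : T.Edge} (h : β.b = α.e) :
    (Q α).x ≤ (Q β).x ∧ (Q β).x + (Q β).side ≤ (Q α).x + (Q α).side ∧
      (Q β).y + (Q β).side = (Q α).y := by
  have hs := (Q β).side_nonneg
  have h1 := hC β α h (show ((Q β).x, (Q β).y + (Q β).side) ∈ (Q β).upperSide from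
    ⟨⟨le_rfl, by linarith⟩, rfl⟩)
  have h2 := hC β α h (show ((Q β).x + (Q β).side, (Q β).y + (Q β).side) ∈ (Q β).upperSide from
    ⟨⟨by linarith, le_rfl⟩, rfl⟩)
  exact ⟨h1.1.1, h2.1.2, h1.2⟩

theorem bounds_of_precedes (hC : T.PrescribesCombinatorics Q) {α β : T.Edge}
    (h : α.Precedes β) : (Q α).x ≤ (Q β).x ∧ (Q β).x + (Q β).side ≤ (Q α).x + (Q α).side ∧
      (Q α).side ≥ (Q β).side ∧ (Q β).y + (Q β).side ≤ (Q α).y + (Q α).side := by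
  induction β using induction_children with
  | h0 β hβ => rw [(precedes_root_iff hβ).1 h]; simp
  | h1 γ β hβ ih =>
    rcases (precedes_child_iff hβ).1 h with rfl | h
    · simp
    · have h1 := ih h
      have h2 := hC.bounds_of_child hβ
      have h3 := (Q γ).side_nonneg
      refine ⟨?_, ?_, ?_, ?_⟩ <;> linarith

theorem top_le_bottom (hC : T.PrescribesCombinatorics Q) {α β : T.Edge}
    (h : α.Precedes β) (hne : α ≠ β) : (Q β).y + (Q β).side ≤ (Q α).y := by
  obtain ⟨γ, hγ, h⟩ := h.eq_or_exists_child.resolve_left hne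
  exact (hC.bounds_of_precedes h).2.2.2.trans_eq (hC.bounds_of_child hγ).2.2

/-- Siblings have their tops at the same height, the bottom of their parent; horizontal overlap
would make the interiors meet just below it. -/
theorem separated (hC : T.PrescribesCombinatorics Q)
    (hd : ∀ i j, i ≠ j → Disjoint (interior (Q i).carrier) (interior (Q j).carrier))
    {α β : T.Edge} (h : α.b = β.b) (hne : α ≠ β) (hα : 0 < (Q α).side) (hβ : 0 < (Q β).side) :
    (Q α).x + (Q α).side ≤ (Q β).x ∨ (Q β).x + (Q β).side ≤ (Q α).x := by
  have hr : α.b ≠ T.root := fun hr => hne (eq_of_b_eq_root hr (h ▸ hr))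
  obtain ⟨γ, hγ⟩ := exists_parent hr
  have h1 := (hC.bounds_of_child hγ).2.2
  have h2 := (hC.bounds_of_child (h.symm.trans hγ)).2.2
  by_contra! hlt
  obtain ⟨x, hx1, hx2⟩ := exists_between (show max (Q α).x (Q β).x <
    min ((Q α).x + (Q α).side) ((Q β).x + (Q β).side) by
      rw [lt_min_iff, max_lt_iff, max_lt_iff]
      exact ⟨⟨by linarith, hlt.1⟩, hlt.2, by linarith⟩)
  obtain ⟨y, hy1, hy2⟩ := exists_between (show max (Q α).y (Q β).y < (Q γ).y by
    rw [max_lt_iff]; constructor <;> linarith)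
  rw [max_lt_iff] at hx1 hy1
  rw [lt_min_iff] at hx2
  refine Set.disjoint_left.1 (hd α β hne) 
    (show (x, y) ∈ _ from ?_) (show (x, y) ∈ _ from ?_) <;> rw [PlaneSquare.interior_carrier]
  · exact ⟨⟨hx1.1, hx2.1⟩, hy1.1, by rw [h1]; exact hy2⟩
  · exact ⟨⟨hx1.2, hx2.2⟩, hy1.2, by rw [h2]; exact hy2⟩

end PrescribesCombinatorics

section Converse

variable {Q : T.Edge → PlaneSquare} {c : ℝ}

theorem _root_.IsSquareTiling.bounds {ι : Type*} {Q : ι → PlaneSquare}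
    (hQ : IsSquareTiling Q (Set.Icc 0 c ×ˢ Set.Icc 0 1)) (i : ι) :
    0 ≤ (Q i).x ∧ (Q i).x + (Q i).side ≤ c ∧ 0 ≤ (Q i).y ∧ (Q i).y + (Q i).side ≤ 1 := by
  have hsub : (Q i).carrier ⊆ Set.Icc 0 c ×ˢ Set.Icc 0 1 :=
    (Set.subset_iUnion _ i).trans (subset_closure.trans hQ.closure_eq.subset)
  have hs := (Q i).side_nonneg
  have h1 := hsub (show ((Q i).x, (Q i).y) ∈ (Q i).carrier from
    ⟨⟨le_rfl, by linarith⟩, le_rfl, by linarith⟩)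
  have h2 := hsub (show ((Q i).x + (Q i).side, (Q i).y + (Q i).side) ∈ (Q i).carrier from
    ⟨⟨by linarith, le_rfl⟩, by linarith, le_rfl⟩)
  exact ⟨h1.1.1, h2.1.2, h1.2.1, h2.2.2⟩

/-- All squares lie in the vertical strip of the root square and below its top, hence so does the
closure of their union, including the upper corners of the rectangle. -/
theorem root_square (hc : 0 < c) (hQ : IsSquareTiling Q (Set.Icc 0 c ×ˢ Set.Icc 0 1))
    (hC : T.PrescribesCombinatorics Q) {ω : T.Edge} (hω : ω.b = T.root) :
    (Q ω).side = c ∧ (Q ω).y + (Q ω).side = 1 := by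
  have hsub : Set.Icc 0 c ×ˢ Set.Icc 0 1 ⊆
      Set.Icc (Q ω).x ((Q ω).x + (Q ω).side) ×ˢ Set.Iic ((Q ω).y + (Q ω).side) := by
    rw [← hQ.closure_eq]
    refine closure_minimal (Set.iUnion_subset fun α => ?_) (isClosed_Icc.prod isClosed_Iic)
    have h := hC.bounds_of_precedes (root_precedes hω α)
    exact Set.prod_mono (Set.Icc_subset_Icc h.1 h.2.1) fun y hy => hy.2.trans h.2.2.2
  have h1 := hsub (show ((0 : ℝ), (1 : ℝ)) ∈ _ from ⟨⟨le_rfl, hc.le⟩, zero_le_one, le_rfl⟩)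
  have h2 := hsub (show (c, (1 : ℝ)) ∈ _ from ⟨⟨hc.le, le_rfl⟩, zero_le_one, le_rfl⟩)
  have h3 := hQ.bounds ω
  have h4 : (Q ω).x ≤ 0 := h1.1.1
  have h5 : c ≤ (Q ω).x + (Q ω).side := h2.1.2
  have h6 : 1 ≤ (Q ω).y + (Q ω).side := h1.2
  constructor <;> linarith

theorem pathSum_side (hc : 0 < c) (hQ : IsSquareTiling Q (Set.Icc 0 c ×ˢ Set.Icc 0 1))
    (hC : T.PrescribesCombinatorics Q) (α : T.Edge) :
    pathSum (fun β => (Q β).side) α = 1 - (Q α).y := by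
  induction α using induction_children with
  | h0 α hα =>
    rw [pathSum_root _ hα]
    linarith [(root_square hc hQ hC hα).2]
  | h1 γ α hα ih =>
    rw [pathSum_child _ hα, ih]
    linarith [(hC.bounds_of_child hα).2.2]

theorem sum_children_side_le (hQ : IsSquareTiling Q (Set.Icc 0 c ×ˢ Set.Icc 0 1))
    (hC : T.PrescribesCombinatorics Q) (α : T.Edge) :
    ∑ β ∈ α.children, (Q β).side ≤ (Q α).side := by
  have hU : ⋃ β ∈ α.children, Set.Ioo (Q β).x ((Q β).x + (Q β).side) ⊆
      Set.Icc (Q α).x ((Q α).x + (Q α).side) := by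
    refine Set.iUnion₂_subset fun β hβ => ?_
    have h := hC.bounds_of_child (mem_children.1 hβ)
    exact Set.Ioo_subset_Icc_self.trans (Set.Icc_subset_Icc h.1 h.2.1)
  have hm := measure_mono (μ := volume) hU
  rw [measure_biUnion_finset (fun β hβ γ hγ hne => ?_) fun _ _ => measurableSet_Ioo] at hm
  · simp only [Real.volume_Ioo, Real.volume_Icc, add_sub_cancel_left] at hm
    rwa [← ENNReal.ofReal_sum_of_nonneg fun β _ => (Q β).side_nonneg,
      ENNReal.ofReal_le_ofReal_iff (Q α).side_nonneg] at hm
  · refine Set.disjoint_left.2 fun x hx hx' => ?_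
    have hb : β.b = γ.b := (mem_children.1 hβ).trans (mem_children.1 hγ).symm
    rcases hC.separated hQ.disjoint_interior hb hne (by linarith [hx.1, hx.2])
      (by linarith [hx'.1, hx'.2]) with h | h
    · linarith [hx.2, hx'.1]
    · linarith [hx.1, hx'.2]

/-- Below a square which does not touch the bottom of the rectangle, the squares which are not
beyond it cover no area. -/
theorem volume_gap_eq_zero (hQ : IsSquareTiling Q (Set.Icc 0 c ×ˢ Set.Icc 0 1))
    (hC : T.PrescribesCombinatorics Q) {α : T.Edge} (hα : 0 < (Q α).side) (hy : 0 < (Q α).y) :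
    volume (Set.Ioo (Q α).x ((Q α).x + (Q α).side) \
      ⋃ β ∈ α.children, Set.Icc (Q β).x ((Q β).x + (Q β).side)) = 0 := by
  set G := Set.Ioo (Q α).x ((Q α).x + (Q α).side) \
      ⋃ β ∈ α.children, Set.Icc (Q β).x ((Q β).x + (Q β).side) with hG
  have hbα := hQ.bounds α
  -- Squares beyond `α` stay under its children, predecessors of `α` lie above the strip, and all
  -- other nondegenerate squares are separated horizontally. Full area thus makes the strip null;
  -- its height is positive, so `G` is null.
  have hnull : ∀ γ, volume ((G ×ˢ Set.Ioo 0 (Q α).y) ∩ (Q γ).carrier) = 0 := by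
    intro γ
    rcases (Q γ).side_nonneg.eq_or_lt with hs | hs
    · refine measure_mono_null Set.inter_subset_right ?_
      rw [PlaneSquare.volume_carrier, ← hs]
      simp
    suffices h : ∀ p : ℝ × ℝ, p ∈ G ×ˢ Set.Ioo 0 (Q α).y → p ∉ (Q γ).carrier by
      rw [(Set.disjoint_left.2 h).inter_eq, measure_empty]
    rintro ⟨x, y⟩ ⟨⟨hx, hxU⟩, hy0, hyα⟩ ⟨hxγ, hyγ⟩
    simp only at hx hxU hy0 hyα hxγ hyγ
    rcases trichotomy α γ with h | h | ⟨α', γ', h1, h2, h3, h4⟩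
    · rcases h.eq_or_exists_child with rfl | ⟨β, hβ, h⟩
      · linarith [hyγ.1]
      · have hb := hC.bounds_of_precedes h
        exact hxU (Set.mem_biUnion (mem_children.2 hβ)
          ⟨hb.1.trans hxγ.1, hxγ.2.trans hb.2.1⟩)
    · by_cases he : γ = α
      · subst he; linarith [hyγ.1]
      · linarith [hC.top_le_bottom h he, hyγ.1]
    · have h5 := hC.bounds_of_precedes h3
      have h6 := hC.bounds_of_precedes h4
      rcases hC.separated hQ.disjoint_interior h1 h2 (hα.trans_le h5.2.2.1)
        (hs.trans_le h6.2.2.1) with h | h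
      · linarith [hx.2, hxγ.1]
      · linarith [hx.1, hxγ.2]
  have hstrip : volume (G ×ˢ Set.Ioo 0 (Q α).y : Set (ℝ × ℝ)) = 0 := by
    refine measure_mono_null (t := (⋃ γ, (G ×ˢ Set.Ioo 0 (Q α).y) ∩ (Q γ).carrier) ∪
      ((Set.Icc 0 c ×ˢ Set.Icc 0 1) \ ⋃ i, (Q i).carrier)) (fun p hp => ?_)
      (measure_union_null (measure_iUnion_null hnull) hQ.volume_diff)
    rw [← Set.inter_iUnion]
    by_cases h : p ∈ ⋃ i, (Q i).carrier
    · exact .inl ⟨hp, h⟩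
    · obtain ⟨⟨hx, -⟩, hy⟩ := hp
      exact .inr ⟨⟨⟨by linarith [hx.1], by linarith [hx.2]⟩, hy.1.le, by linarith [hy.2]⟩, h⟩
  rw [Measure.volume_eq_prod, Measure.prod_prod, mul_eq_zero, Real.volume_Ioo] at hstrip
  refine hstrip.resolve_right ?_
  simpa using hy

theorem isFlow_side (hQ : IsSquareTiling Q (Set.Icc 0 c ×ˢ Set.Icc 0 1))
    (hC : T.PrescribesCombinatorics Q) (hD : T.DegeneratesOnlyProperly Q) :
    IsFlow fun α => (Q α).side := by
  refine ⟨fun α => (Q α).side_nonneg, fun α hl => ?_⟩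
  refine le_antisymm (sum_children_side_le hQ hC α) ?_
  rcases (Q α).side_nonneg.eq_or_lt with hs | hs
  · rw [← hs]
    exact Finset.sum_nonneg fun β _ => (Q β).side_nonneg
  -- A nondegenerate child fits between this square and the bottom of the rectangle, so there is
  -- room for the strip argument.
  obtain ⟨β, hβ, hβs⟩ := hD α hl hs
  have hy : 0 < (Q α).y := by
    linarith [(hC.bounds_of_child hβ).2.2, (hQ.bounds β).2.2.1]
  have h := measure_le_inter_add_sdiff volume (Set.Ioo (Q α).x ((Q α).x + (Q α).side))
    (⋃ β ∈ α.children, Set.Icc (Q β).x ((Q β).x + (Q β).side))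
  rw [volume_gap_eq_zero hQ hC hs hy, add_zero] at h
  have h' := (h.trans (measure_mono Set.inter_subset_right)).trans
    (measure_biUnion_finset_le α.children _)
  simp only [Real.volume_Ioo, Real.volume_Icc, add_sub_cancel_left] at h'
  rwa [← ENNReal.ofReal_sum_of_nonneg fun β _ => (Q β).side_nonneg,
    ENNReal.ofReal_le_ofReal_iff (Finset.sum_nonneg fun β _ => (Q β).side_nonneg)] at h'

end Converse

/-! ### Duality and the choice of an `F_σ` set. -/

/-- A measure of mass equal to its energy bounds from below the capacity of the sets which
carry it. -/
theorem measure_univ_le_capacity {E : Set T.Boundary} {μ : Measure T.Boundary}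
    [IsFiniteMeasure μ] (hE : μ Set.univ ≤ μ E)
    (henergy : ∑' α, T.copotential μ α ^ 2 = μ Set.univ) : μ Set.univ ≤ T.capacity E := by
  refine le_iInf₂ fun f hf => ?_
  -- Integrating the admissibility condition pairs `f` with the co-potential. The inequality `2ab ≤
  -- a² + b²` then allows the energy, equal to the finite mass, to be cancelled.
  have h1 : μ Set.univ ≤ ∑' α, f α * T.copotential μ α := by
    rw [← lintegral_potential]
    have := mul_meas_ge_le_lintegral (μ := μ) (measurable_potential f) 1
    rw [one_mul] at this
    exact (hE.trans (measure_mono hf)).trans this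
  have h2 : μ Set.univ + μ Set.univ ≤ ∑' α, f α ^ 2 + μ Set.univ := by
    calc μ Set.univ + μ Set.univ = 2 * μ Set.univ := (two_mul _).symm
      _ ≤ 2 * ∑' α, f α * T.copotential μ α := by gcongr
      _ = ∑' α, 2 * (f α * T.copotential μ α) := ENNReal.tsum_mul_left.symm
      _ ≤ ∑' α, (f α ^ 2 + T.copotential μ α ^ 2) :=
          ENNReal.tsum_le_tsum fun α => ENNReal.two_mul_mul_le_sq_add_sq _ _
      _ = _ := by rw [ENNReal.tsum_add, henergy]
  exact (ENNReal.add_le_add_iff_right (measure_ne_top μ _)).1 h2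

theorem exists_Fsigma_measure_ge {X : Type*} [TopologicalSpace X] [MeasurableSpace X]
    {μ : Measure X} [IsFiniteMeasure μ] [μ.WeaklyRegular] {G : Set X} (hG : MeasurableSet G) :
    ∃ K : ℕ → Set X, (∀ n, IsClosed (K n)) ∧ (∀ n, K n ⊆ G) ∧ μ G ≤ μ (⋃ n, K n) := by
  choose K hKG hK hlt using fun n : ℕ =>
    -- At `n = 0` the tolerance is `∞`, which is harmless.
    hG.exists_isClosed_lt_add (μ := μ) (measure_ne_top μ G) (ε := (n : ℝ≥0∞)⁻¹) (by simp)
  refine ⟨K, hK, hKG, ?_⟩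
  by_contra! h
  obtain ⟨n, hn⟩ := ENNReal.exists_inv_nat_lt (tsub_pos_iff_lt.2 h).ne'
  refine (hlt n).not_ge ?_
  calc μ (K n) + (n : ℝ≥0∞)⁻¹ ≤ μ (⋃ n, K n) + (μ G - μ (⋃ n, K n)) :=
        add_le_add (measure_mono (Set.subset_iUnion K n)) hn.le
    _ = μ G := add_tsub_cancel_of_le h.le

/-- A measure whose mass is its energy and whose potential is at most one is the equilibrium
measure of an `F_σ` set. -/
theorem exists_Fsigma_isEquilibriumMeasure {μ : Measure T.Boundary} [IsFiniteMeasure μ]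
    (henergy : ∑' α, T.copotential μ α ^ 2 = μ Set.univ)
    (hle : ∀ ζ, T.potential (T.copotential μ) ζ ≤ 1) :
    ∃ E : Set T.Boundary, (∃ K : ℕ → Set T.Boundary, (∀ n, IsClosed (K n)) ∧ E = ⋃ n, K n) ∧
      T.IsEquilibriumMeasure E μ := by
  have hint : ∫⁻ ζ, T.potential (T.copotential μ) ζ ∂μ = μ Set.univ := by
    rw [lintegral_potential, ← henergy]
    simp_rw [sq]
  -- The potential is at most 1 and its integral, the energy, equals the integral of 1.
  have hae : T.potential (T.copotential μ) =ᵐ[μ] fun _ => 1 :=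
    ae_eq_of_ae_le_of_lintegral_le (Filter.Eventually.of_forall hle)
      (by rw [hint]; exact measure_ne_top μ _) aemeasurable_const (by simp [hint])
  obtain ⟨K, hK, hKG, hμK⟩ := exists_Fsigma_measure_ge (μ := μ)
    (measurableSet_le measurable_const (measurable_potential (T.copotential μ)) :
      MeasurableSet {ζ | 1 ≤ T.potential (T.copotential μ) ζ})
  rw [measure_congr (Filter.eventuallyEq_univ.2 (hae.mono fun ζ hζ => hζ.ge))] at hμK
  have hE : ∀ ζ ∈ ⋃ n, K n, 1 ≤ T.potential (T.copotential μ) ζ := fun ζ hζ => by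
    obtain ⟨n, hn⟩ := Set.mem_iUnion.1 hζ
    exact hKG n hn
  have hcap : μ Set.univ = T.capacity (⋃ n, K n) :=
    le_antisymm (measure_univ_le_capacity hμK henergy)
      (henergy ▸ capacity_le_of_potential hE)
  refine ⟨_, ⟨K, hK, rfl⟩, ?_, henergy.trans hcap, hcap⟩
  convert capacity_empty (T := T)
  exact Set.eq_empty_of_forall_notMem fun ζ hζ => (hE ζ hζ.1).not_gt hζ.2

end PlantedTree

open PlantedTree in
theorem mainTheorem3 {V : Type*} (T : PlantedTree V) :
    (∀ E : Set T.Boundary,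
      (∃! μ : Measure T.Boundary, T.IsEquilibriumMeasure E μ) ∧
      (0 < T.capacity E → ∀ μ : Measure T.Boundary, T.IsEquilibriumMeasure E μ →
        ∃ Q : T.Edge → PlaneSquare,
          IsSquareTiling Q (Set.Icc 0 (T.capacity E).toReal ×ˢ Set.Icc 0 1) ∧
          T.PrescribesCombinatorics Q ∧
          ∀ α, ENNReal.ofReal (Q α).side = μ (T.tentBoundary α))) ∧
    (∀ (c : ℝ) (Q : T.Edge → PlaneSquare), 0 < c →
      IsSquareTiling Q (Set.Icc 0 c ×ˢ Set.Icc 0 1) →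
      T.PrescribesCombinatorics Q →
      T.DegeneratesOnlyProperly Q →
      ∃ E : Set T.Boundary,
        (∃ K : ℕ → Set T.Boundary, (∀ n, IsClosed (K n)) ∧ E = ⋃ n, K n) ∧
        ∃ μ : Measure T.Boundary, T.IsEquilibriumMeasure E μ ∧
          ∀ α, μ (T.tentBoundary α) = ENNReal.ofReal (Q α).side) := by
  refine ⟨fun E => ⟨existsUnique_isEquilibriumMeasure E, fun hE μ hμ => ?_⟩,
    fun c Q hc hQ hC hD => ?_⟩
  · obtain ⟨f, hf, hfμ⟩ := hμ.exists_isMinimizer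
    obtain ⟨Q, h1, h2, h3⟩ := hf.exists_isSquareTiling hE
    exact ⟨Q, h1, h2, fun α => by rw [h3, hfμ]⟩
  · obtain ⟨μ, hμ⟩ := (isFlow_side hQ hC hD).exists_measure
    obtain ⟨ω, hω⟩ := Edge.exists_b_eq_root T
    have hM : T.copotential μ = fun α => ENNReal.ofReal (Q α).side := funext hμ
    have huniv : μ Set.univ = ENNReal.ofReal c := by
      rw [← tentBoundary_root hω, hμ, (root_square hc hQ hC hω).1]
    have : IsFiniteMeasure μ := ⟨by rw [huniv]; exact ENNReal.ofReal_lt_top⟩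
    obtain ⟨E, hE, hEμ⟩ := exists_Fsigma_isEquilibriumMeasure (μ := μ)
      (by rw [hM, huniv, hQ.tsum_sq]) fun ζ => by
        rw [hM, potential_eq_iSup]
        refine iSup₂_le fun α _ => ?_
        rw [pathSum_ofReal fun α => (Q α).side_nonneg, pathSum_side hc hQ hC,
          ENNReal.ofReal_le_one]
        linarith [(hQ.bounds α).2.2.1]
    exact ⟨E, hE, μ, hEμ, hμ⟩
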